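/- Let $H:[0,\infty)\to[0,1]$ be Borel measurable with $\|H\|_1=\int_0^\infty H(r)\,dr<\infty$. For $L>0$ consider the soft random geometric graph on $[0,L]$ with periodic boundary conditions: the node set is a Poisson point process $\Phi$ of intensity $1$ on $[0,L]$ and, given $\Phi$, each pair of distinct nodes $x,y$ is joined by an edge independently of all other pairs with probability $H(\rho(x,y))$, where $\rho(x,y)=\min(|x-y|,\,L-|x-y|)$ is the toroidal distance. Let $N_{\mathrm{iso}}$ be the number of isolated nodes (nodes having no edge to any other node), and let $c_V^2(X)=\operatorname{Var}(X)/(\mathbb E X)^2$ denote the squared coefficient of variation. (1) There is a finite constant $C$, depending on $H$ but not on $L$, such that for every $L>0$ the variable $N_{\mathrm{iso}}$ is square integrable, $$\mathbb E[N_{\mathrm{iso}}]=L\exp\Bigl(-2\int_0^{L/2}H(r)\,dr\Bigr),\qquad c_V^2(N_{\mathrm{iso}})\le\frac1{\mathbb E[N_{\mathrm{iso}}]}+\frac{4C}{L}\|H\|_1^2,$$ and, for every $\varepsilon>0$, $$\mathbb P\bigl(|N_{\mathrm{iso}}-\mathbb E[N_{\mathrm{iso}}]|>\varepsilon\,\mathbb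 E[N_{\mathrm{iso}}]\bigr)\le\frac{c_V^2(N_{\mathrm{iso}})}{\varepsilon^2}.$$ (2) Consequently $N_{\mathrm{iso}}$ concentrates around its mean and grows linearly in $L$: as $L\to\infty$ (with $H$ fixed), $\mathbb E[N_{\mathrm{iso}}]/L\to e^{-2\|H\|_1}$, and for every $\varepsilon>0$ $$\mathbb P\bigl(|N_{\mathrm{iso}}-\mathbb E[N_{\mathrm{iso}}]|>\varepsilon\,\mathbb E[N_{\mathrm{iso}}]\bigr)\to0,\qquad \mathbb P\bigl(|N_{\mathrm{iso}}/L-e^{-2\|H\|_1}|>\varepsilon\bigr)\to0 .$$ -/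

import Mathlib

open MeasureTheory ProbabilityTheory Filter Topology

universe u

noncomputable section

/-- The number `Φ(B)` of points of the random finite set `Φ` that lie in `B`. -/
def pointCount {Ω : Type u} (Φ : Ω → Finset ℝ) (B : Set ℝ) (ω : Ω) : ℕ :=
  ((Φ ω : Set ℝ) ∩ B).ncard

/-- `Φ` is a homogeneous Poisson point process of intensity `1` on the interval `[0, L]`:
the number of points in a Borel set `B` is Poisson distributed with mean the length of
`B ∩ [0, L]`, and the numbers of points in disjoint Borel sets are mutually independent. -/
structure IsUnitPoissonProcess {Ω : Type u} [MeasurableSpace Ω] (P : Measure Ω) (L : ℝ)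
    (Φ : Ω → Finset ℝ) : Prop where
  subset_Icc : ∀ ω, (Φ ω : Set ℝ) ⊆ Set.Icc 0 L
  measurable_count : ∀ B : Set ℝ, MeasurableSet B → Measurable (pointCount Φ B)
  count_law : ∀ B : Set ℝ, MeasurableSet B →
    P.map (pointCount Φ B) = poissonMeasure (volume (B ∩ Set.Icc 0 L)).toNNReal
  count_indep : ∀ (n : ℕ) (B : Fin n → Set ℝ), (∀ i, MeasurableSet (B i)) →
    Pairwise (fun i j => Disjoint (B i) (B j)) →
    iIndepFun (fun i => pointCount Φ (B i)) P

/-- The σ-algebra on `Ω` generated by the point configuration `Φ`, that is, by the numbers of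
points in Borel sets. -/
@[reducible] def configSigma {Ω : Type u} (Φ : Ω → Finset ℝ) : MeasurableSpace Ω :=
  ⨆ (B : Set ℝ) (_ : MeasurableSet B), MeasurableSpace.comap (pointCount Φ B) ⊤

/-- The toroidal distance between two points of `[0, L]`, the endpoints being identified. -/
def torusDist (L x y : ℝ) : ℝ := min |x - y| (L - |x - y|)

/-- The soft random geometric graph on `[0, L]` with periodic boundary conditions and connection
function `H`. The node set is a Poisson process `Φ` of unit intensity. The pair of nodes `x`, `y`
is joined by an edge when `(G ω).Adj x y` (adjacency outside `Φ ω` plays no role).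

The field `edges` says that, given the configuration `Φ`, the edges between the different
unordered pairs of distinct nodes are independent, and that the edge between `x` and `y` is
present with probability `H (ρ(x, y))`, where `ρ` is the toroidal distance: whenever `k` different
pairs of nodes are selected on an event `A`, the event and the selection being determined by the
configuration, the conditional probability that all of these pairs are edges is the product of the
`k` connection probabilities. -/
structure IsSoftRGG {Ω : Type u} [MeasurableSpace Ω] (P : Measure Ω) (L : ℝ) (H : ℝ → ℝ)
    (Φ : Ω → Finset ℝ) (G : Ω → SimpleGraph ℝ) : Prop where
  nodes : IsUnitPoissonProcess P L Φ
  edges : ∀ (k : ℕ) (x y : Fin k → Ω → ℝ) (A : Set Ω),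
    MeasurableSet[configSigma Φ] A →
    (∀ i, Measurable[configSigma Φ] (x i)) → (∀ i, Measurable[configSigma Φ] (y i)) →
    (∀ ω ∈ A, ∀ i, x i ω ∈ Φ ω ∧ y i ω ∈ Φ ω ∧ x i ω ≠ y i ω) →
    (∀ ω ∈ A, ∀ i j, i ≠ j → s(x i ω, y i ω) ≠ s(x j ω, y j ω)) →
    MeasurableSet {ω | ω ∈ A ∧ ∀ i, (G ω).Adj (x i ω) (y i ω)} ∧
    P {ω | ω ∈ A ∧ ∀ i, (G ω).Adj (x i ω) (y i ω)} =
      ∫⁻ ω in A, ∏ i, ENNReal.ofReal (H (torusDist L (x i ω) (y i ω))) ∂P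

/-- The number of isolated nodes: nodes with no edge to any other node. -/
def numIsolated {Ω : Type u} (Φ : Ω → Finset ℝ) (G : Ω → SimpleGraph ℝ) (ω : Ω) : ℝ :=
  (({x : ℝ | x ∈ Φ ω ∧ ∀ y ∈ Φ ω, y ≠ x → ¬ (G ω).Adj x y} : Set ℝ).ncard : ℝ)

/-- The squared coefficient of variation: the variance divided by the squared mean. -/
def sqCoeffVar {Ω : Type u} [MeasurableSpace Ω] (P : Measure Ω) (X : Ω → ℝ) : ℝ :=
  variance X P / (∫ ω, X ω ∂P) ^ 2

/-- The norm `‖H‖₁ = ∫₀^∞ H` of a nonnegative function `H` on the half-line. -/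
def l1Norm (H : ℝ → ℝ) : ℝ := ∫ r in Set.Ioi (0 : ℝ), H r

end

/-! The proof is a second moment computation. Write `p` for the connection probability and `I =
∫₀^{L/2} H`. Given the configuration, a node `x` is isolated with probability `∏ (1 - p(x, y))` over
the other nodes. Two nodes `x`, `x'` are both isolated with probability the product of `1 - p` over
all pairs that meet `{x, x'}`, the pair `{x, x'}` itself counted once. Mecke's formula, used once or
twice, turns the expected sums over nodes into integrals over `[0, L]` and `[0, L]²`. The generating
functional `E ∏ v = exp (∫ v - L)` evaluates what remains.

Invariance of the torus gives `∫ p(x, y) dy = 2 I` for every `x`, hence the mean `L exp (-2 I)`. For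
pairs the exponent is `-4 I + q(x, x')`, where `q = ∫ p(x, y) p(x', y) dy` carries all the
correlation. Since `0 ≤ q ≤ 2 I ≤ 2 ‖H‖₁`, one has `exp q ≤ 1 + C q` with `C = exp (2 ‖H‖₁)`, and
Tonelli gives `∬ q = L (2 I)²`. So the second factorial moment exceeds the squared mean by at most
`exp (-4 I) · C · L (2 I)²`. Dividing by the squared mean yields the bound; Chebyshev and `I → ‖H‖₁`
give the rest.

Two points need real work. The Poisson process is given only by its counts, so Mecke's formula is
derived: the reduced Campbell measure and the product measure are compared on rectangles `B × {no
point in A}`, which form a generating π-system (`campbellMeasure_eq`). The edge law speaks only of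
edges being present between measurably selected nodes, so nodes are selected by rank (`ostat`) and
absent edges are reached by inclusion–exclusion (`measure_edges_nonedges`). -/

noncomputable section

open scoped ENNReal Classical

/-! ### The σ-algebra on finite configurations and avoidance events -/

/-- The number of points of the finite set `s` in `B`. -/
def cnt (B : Set ℝ) (s : Finset ℝ) : ℕ := ((s : Set ℝ) ∩ B).ncard

/-- The σ-algebra on finite configurations generated by the numbers of points in Borel sets. -/
instance configMeasurableSpace : MeasurableSpace (Finset ℝ) :=
  ⨆ (B : Set ℝ) (_ : MeasurableSet B), MeasurableSpace.comap (cnt B) ⊤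

theorem cnt_eq_card_filter (B : Set ℝ) [DecidablePred (· ∈ B)] (s : Finset ℝ) : cnt B s = (s.filter (· ∈ B)).card := by
  rw [cnt, ← Set.ncard_coe_finset]
  congr 1
  ext x
  simp

theorem cnt_eq_zero_iff (B : Set ℝ) (s : Finset ℝ) : cnt B s = 0 ↔ ∀ x ∈ s, x ∉ B := by
  rw [cnt_eq_card_filter, Finset.card_eq_zero, Finset.filter_eq_empty_iff]

theorem cnt_univ (s : Finset ℝ) : cnt Set.univ s = s.card := by
  simp [cnt_eq_card_filter]

theorem measurable_cnt {B : Set ℝ} (hB : MeasurableSet B) : Measurable (cnt B) := by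
  have h : MeasurableSpace.comap (cnt B) ⊤ ≤ configMeasurableSpace :=
    le_iSup₂_of_le (f := fun (B : Set ℝ) (_ : MeasurableSet B) =>
      MeasurableSpace.comap (cnt B) ⊤) B hB le_rfl
  exact Measurable.mono (comap_measurable (m := ⊤) (cnt B)) h le_rfl

theorem measurable_card : Measurable (fun s : Finset ℝ => s.card) := by
  simpa only [← cnt_univ] using measurable_cnt MeasurableSet.univ

/-- Any measurable functional of a finite set, such as a point of given rank, thereby becomes an
admissible selection in the field `edges`. -/
theorem configSigma_eq_comap {Ω : Type u} (Φ : Ω → Finset ℝ) :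
    configSigma Φ = configMeasurableSpace.comap Φ := by
  simp only [configSigma, configMeasurableSpace, MeasurableSpace.comap_iSup,
    MeasurableSpace.comap_comp]
  rfl

theorem measurable_of_measurable_cnt {α : Type*} [MeasurableSpace α] {f : α → Finset ℝ}
    (h : ∀ B : Set ℝ, MeasurableSet B → Measurable fun a => cnt B (f a)) : Measurable f := by
  rw [measurable_iff_comap_le, configMeasurableSpace]
  simp only [MeasurableSpace.comap_iSup, MeasurableSpace.comap_comp]
  exact iSup₂_le fun B hB => (h B hB).comap_le

/-- The event that a configuration has no point in `A`. -/
def voidEvent (A : Set ℝ) : Set (Finset ℝ) := {s | cnt A s = 0}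

/-- The avoidance events of Borel sets. -/
def voidEvents : Set (Set (Finset ℝ)) := {E | ∃ A, MeasurableSet A ∧ voidEvent A = E}

theorem measurableSet_voidEvent {A : Set ℝ} (hA : MeasurableSet A) :
    MeasurableSet (voidEvent A) :=
  measurable_cnt hA (MeasurableSet.singleton 0)

theorem isPiSystem_voidEvents : IsPiSystem voidEvents := by
  rintro _ ⟨A, hA, rfl⟩ _ ⟨B, hB, rfl⟩ -
  refine ⟨A ∪ B, hA.union hB, ?_⟩
  ext s
  simp only [voidEvent, Set.mem_ofPred_eq, cnt_eq_zero_iff, Set.mem_inter_iff, Set.mem_union]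
  grind

/-- A rational cut just below the largest point of `s` in `A` splits off that point. This expresses
large counts through countably many avoidance events, by induction on `k`. -/
theorem succ_le_cnt_iff (A : Set ℝ) (k : ℕ) (s : Finset ℝ) :
    k + 1 ≤ cnt A s ↔
      ∃ q : ℚ, k ≤ cnt (A ∩ Set.Iio (q : ℝ)) s ∧ cnt (A ∩ Set.Ici (q : ℝ)) s ≠ 0 := by
  constructor
  · intro h
    rw [cnt_eq_card_filter] at h
    have hne : (s.filter (· ∈ A)).Nonempty := Finset.card_pos.1 (by omega)
    set m := (s.filter (· ∈ A)).max' hne with hm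
    have hmem : m ∈ s.filter (· ∈ A) := Finset.max'_mem _ _
    -- By finiteness there is room for a cut between the maximum `m` and all the other points.
    have hev : ∀ᶠ q in 𝓝[<] m, ∀ x ∈ (s.filter (· ∈ A)).erase m, x < q := by
      rw [Filter.eventually_all_finset]
      intro x hx
      have hxm : x < m := lt_of_le_of_ne
        (Finset.le_max' _ _ (Finset.mem_of_mem_erase hx)) (Finset.ne_of_mem_erase hx)
      exact (eventually_gt_nhds hxm).filter_mono nhdsWithin_le_nhds
    obtain ⟨r, hr, hrm⟩ := (hev.and self_mem_nhdsWithin).exists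
    obtain ⟨q, hq1, hq2⟩ := exists_rat_btwn (show r < m from hrm)
    refine ⟨q, ?_, ?_⟩
    · rw [cnt_eq_card_filter]
      have hsub : (s.filter (· ∈ A)).erase m ⊆ s.filter (· ∈ A ∩ Set.Iio (q : ℝ)) := by
        intro x hx
        have h1 := hr x hx
        have h2 := Finset.mem_filter.1 (Finset.mem_of_mem_erase hx)
        exact Finset.mem_filter.2 ⟨h2.1, h2.2, h1.trans hq1⟩
      have := Finset.card_le_card hsub
      rw [Finset.card_erase_of_mem hmem] at this
      omega
    · rw [Ne, cnt_eq_zero_iff]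
      intro hcon
      have h2 := Finset.mem_filter.1 hmem
      exact hcon m h2.1 ⟨h2.2, hq2.le⟩
  · rintro ⟨q, h1, h2⟩
    rw [cnt_eq_card_filter] at h1 h2 ⊢
    have hd : Disjoint (s.filter (· ∈ A ∩ Set.Iio (q : ℝ))) (s.filter (· ∈ A ∩ Set.Ici (q : ℝ))) := by
      rw [Finset.disjoint_left]
      intro x hx hx'
      exact absurd (Set.mem_Iio.1 (Finset.mem_filter.1 hx).2.2)
        (not_lt.2 (Set.mem_Ici.1 (Finset.mem_filter.1 hx').2.2))
    have := Finset.card_union_of_disjoint hd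
    have hsub : s.filter (· ∈ A ∩ Set.Iio (q : ℝ)) ∪ s.filter (· ∈ A ∩ Set.Ici (q : ℝ)) ⊆
        s.filter (· ∈ A) := by
      intro x hx
      simp only [Finset.mem_union, Finset.mem_filter, Set.mem_inter_iff] at hx ⊢
      tauto
    have := Finset.card_le_card hsub
    omega

/-- With the π-system property, this makes avoidance probabilities enough to identify a finite
measure on configurations. -/
theorem generateFrom_voidEvents :
    MeasurableSpace.generateFrom voidEvents = configMeasurableSpace := by
  apply le_antisymm
  · apply MeasurableSpace.generateFrom_le
    rintro _ ⟨A, hA, rfl⟩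
    exact measurableSet_voidEvent hA
  · have key : ∀ (k : ℕ) (A : Set ℝ), MeasurableSet A →
        MeasurableSet[MeasurableSpace.generateFrom voidEvents] {s | k ≤ cnt A s} := by
      intro k
      induction k with
      | zero =>
        intro A hA
        simp
      | succ k ih =>
        intro A hA
        have : {s | k + 1 ≤ cnt A s} = ⋃ q : ℚ, ({s | k ≤ cnt (A ∩ Set.Iio (q : ℝ)) s} ∩
            (voidEvent (A ∩ Set.Ici (q : ℝ)))ᶜ) := by
          ext s
          simpa [voidEvent] using succ_le_cnt_iff A k s
        rw [this]
        refine MeasurableSet.iUnion fun q => MeasurableSet.inter (ih _ (hA.inter measurableSet_Iio))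
          (MeasurableSet.compl ?_)
        exact MeasurableSpace.measurableSet_generateFrom
          ⟨_, hA.inter measurableSet_Ici, rfl⟩
    refine iSup₂_le fun B hB => Measurable.comap_le (m₂ := ⊤) ?_
    let := MeasurableSpace.generateFrom voidEvents
    have : Measurable (cnt B) := measurable_of_Ici fun k => key k B hB
    exact this

/-! ### Order statistics: measurable enumeration of the nodes -/

/-- The `i`-th smallest point of a finite configuration, and `0` if there is no such point. -/
def ostat (s : Finset ℝ) (i : ℕ) : ℝ :=
  if h : i < s.card then s.orderEmbOfFin rfl ⟨i, h⟩ else 0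

theorem ostat_mem {s : Finset ℝ} {i : ℕ} (h : i < s.card) : ostat s i ∈ s := by
  rw [ostat, dif_pos h]
  exact Finset.orderEmbOfFin_mem s rfl _

theorem ostat_injOn (s : Finset ℝ) : Set.InjOn (ostat s) (Finset.range s.card) := by
  intro i hi j hj hij
  rw [Finset.coe_range, Set.mem_Iio] at hi hj
  rw [ostat, dif_pos hi, ostat, dif_pos hj] at hij
  simpa using hij

theorem image_ostat (s : Finset ℝ) : (Finset.range s.card).image (ostat s) = s := by
  apply Finset.eq_of_subset_of_card_le
  · intro x hx
    obtain ⟨i, hi, rfl⟩ := Finset.mem_image.1 hx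
    exact ostat_mem (Finset.mem_range.1 hi)
  · rw [Finset.card_image_of_injOn (ostat_injOn s), Finset.card_range]

theorem ostat_le_iff {s : Finset ℝ} {i : ℕ} (h : i < s.card) (t : ℝ) :
    ostat s i ≤ t ↔ i < cnt (Set.Iic t) s := by
  rw [ostat, dif_pos h, cnt_eq_card_filter]
  constructor
  · intro hle
    have hsub : (Finset.Iic (⟨i, h⟩ : Fin s.card)).image (s.orderEmbOfFin rfl) ⊆
        s.filter (· ∈ Set.Iic t) := by
      intro x hx
      obtain ⟨j, hj, rfl⟩ := Finset.mem_image.1 hx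
      exact Finset.mem_filter.2 ⟨Finset.orderEmbOfFin_mem s rfl _,
        ((s.orderEmbOfFin rfl).monotone (Finset.mem_Iic.1 hj)).trans hle⟩
    have := Finset.card_le_card hsub
    rw [Finset.card_image_of_injective _ (s.orderEmbOfFin rfl).injective, Fin.card_Iic] at this
    exact this
  · intro hlt
    by_contra! hcon
    have hsub : s.filter (· ∈ Set.Iic t) ⊆
        (Finset.Iio (⟨i, h⟩ : Fin s.card)).image (s.orderEmbOfFin rfl) := by
      intro x hx
      obtain ⟨hx1, hx2⟩ := Finset.mem_filter.1 hx
      rw [← Finset.mem_coe, ← Finset.range_orderEmbOfFin s rfl] at hx1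
      obtain ⟨j, rfl⟩ := hx1
      refine Finset.mem_image.2 ⟨j, Finset.mem_Iio.2 ?_, rfl⟩
      exact (s.orderEmbOfFin rfl).lt_iff_lt.1 (lt_of_le_of_lt hx2 hcon)
    have := Finset.card_le_card hsub
    rw [Finset.card_image_of_injective _ (s.orderEmbOfFin rfl).injective, Fin.card_Iio] at this
    simp only at this
    omega

theorem cnt_le_card (B : Set ℝ) (s : Finset ℝ) : cnt B s ≤ s.card := by
  rw [cnt_eq_card_filter]
  exact Finset.card_filter_le _ _

theorem measurable_ostat (i : ℕ) : Measurable fun s => ostat s i := by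
  refine measurable_of_Iic fun t => ?_
  have : (fun s => ostat s i) ⁻¹' Set.Iic t =
      {s | i < cnt (Set.Iic t) s} ∪ ({s | s.card ≤ i} ∩ {_s | (0 : ℝ) ≤ t}) := by
    ext s
    simp only [Set.mem_preimage, Set.mem_Iic, Set.mem_union, Set.mem_ofPred_eq, Set.mem_inter_iff]
    by_cases h : i < s.card
    · simp [ostat_le_iff h, h]
    · have h1 : ¬ i < cnt (Set.Iic t) s := fun h' => h (h'.trans_le (cnt_le_card _ _))
      simp [ostat, h, h1, not_lt.1 h]
  rw [this]
  exact (measurable_cnt measurableSet_Iic (measurableSet_Ioi (a := i))).union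
    ((measurable_card (measurableSet_Iic (a := i))).inter (MeasurableSet.const _))

theorem sum_eq_sum_ostat {M : Type*} [AddCommMonoid M] (s : Finset ℝ) (f : ℝ → M) :
    ∑ x ∈ s, f x = ∑ i ∈ Finset.range s.card, f (ostat s i) := by
  conv_lhs => rw [← image_ostat s]
  exact Finset.sum_image (ostat_injOn s)

theorem prod_eq_prod_ostat {M : Type*} [CommMonoid M] (s : Finset ℝ) (f : ℝ → M) :
    ∏ x ∈ s, f x = ∏ i ∈ Finset.range s.card, f (ostat s i) := by
  conv_lhs => rw [← image_ostat s]
  exact Finset.prod_image (ostat_injOn s)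

theorem measurable_of_nat_index {α β : Type*} [MeasurableSpace α] [MeasurableSpace β]
    {n : α → ℕ} (hn : Measurable n) {g : ℕ → α → β} (hg : ∀ k, Measurable (g k)) :
    Measurable fun a => g (n a) a := by
  have : Measurable fun p : α × ℕ => g p.2 p.1 :=
    measurable_from_prod_countable_left fun k => hg k
  exact this.comp (measurable_id.prodMk hn)

theorem measurable_sum_config {α : Type*} [MeasurableSpace α] {S : α → Finset ℝ}
    (hS : Measurable S) {f : α → ℝ → ℝ≥0∞}
    (hf : ∀ i, Measurable fun a => f a (ostat (S a) i)) :
    Measurable fun a => ∑ x ∈ S a, f a x := by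
  simp_rw [sum_eq_sum_ostat]
  exact measurable_of_nat_index (measurable_card.comp hS)
    (g := fun n a => ∑ i ∈ Finset.range n, f a (ostat (S a) i))
    fun n => Finset.measurable_fun_sum _ fun i _ => hf i

theorem measurable_prod_config {α : Type*} [MeasurableSpace α] {S : α → Finset ℝ}
    (hS : Measurable S) {f : α → ℝ → ℝ≥0∞} (hf : Measurable fun p : α × ℝ => f p.1 p.2) :
    Measurable fun a => ∏ x ∈ S a, f a x := by
  simp_rw [prod_eq_prod_ostat]
  exact measurable_of_nat_index (measurable_card.comp hS)
    (g := fun n a => ∏ i ∈ Finset.range n, f a (ostat (S a) i))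
    fun n => Finset.measurable_fun_prod _ fun i _ =>
      hf.comp (measurable_id.prodMk ((measurable_ostat i).comp hS))

theorem cnt_erase (B : Set ℝ) (s : Finset ℝ) (x : ℝ) (hx : x ∈ s) :
    cnt B (s.erase x) = cnt B s - B.indicator (fun _ => 1) x := by
  rw [cnt_eq_card_filter, cnt_eq_card_filter, Finset.filter_erase]
  by_cases hB : x ∈ B
  · rw [Finset.card_erase_of_mem (Finset.mem_filter.2 ⟨hx, hB⟩)]
    simp [hB]
  · rw [Finset.erase_eq_of_notMem (by simp [hB])]
    simp [hB]

theorem measurable_erase_ostat (i : ℕ) : Measurable fun s : Finset ℝ => s.erase (ostat s i) := by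
  refine measurable_of_measurable_cnt fun B hB => ?_
  have hB' : Measurable (B.indicator (fun _ => (1 : ℕ))) := measurable_const.indicator hB
  -- When the rank `i` does not exist, `ostat` takes its default value `0`, which may itself be a
  -- point of `s`; hence the middle case.
  have : (fun s : Finset ℝ => cnt B (s.erase (ostat s i))) = fun s =>
      if i < s.card then cnt B s - B.indicator (fun _ => 1) (ostat s i)
      else if 0 ∈ s then cnt B s - B.indicator (fun _ => 1) (0 : ℝ) else cnt B s := by
    funext s
    split_ifs with h h0
    · exact cnt_erase B s _ (ostat_mem h)
    · rw [ostat, dif_neg h]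
      exact cnt_erase B s _ h0
    · rw [ostat, dif_neg h, Finset.erase_eq_of_notMem h0]
  rw [this]
  have h0 : MeasurableSet {s : Finset ℝ | (0 : ℝ) ∈ s} := by
    have : {s : Finset ℝ | (0 : ℝ) ∈ s} = (voidEvent {0})ᶜ := by
      ext s
      simp [voidEvent, cnt_eq_zero_iff]
    rw [this]
    exact (measurableSet_voidEvent (MeasurableSet.singleton 0)).compl
  refine Measurable.ite (measurable_card (measurableSet_Ioi (a := i))) ?_
    (Measurable.ite h0 ?_ (measurable_cnt hB))
  · exact (measurable_cnt hB).sub (hB'.comp (measurable_ostat i))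
  · exact (measurable_cnt hB).sub measurable_const

/-! ### The reduced Campbell measure and Mecke's formula -/

theorem lintegral_natCast_poissonMeasure (r : NNReal) :
    ∫⁻ n, (n : ℝ≥0∞) ∂(poissonMeasure r) = r := by
  have h1 : ∑' n, poissonMeasure r {n} = 1 := by
    have h := measure_univ (μ := poissonMeasure r)
    rw [← lintegral_one, lintegral_countable'] at h
    simpa using h
  rw [lintegral_countable', tsum_eq_zero_add' ENNReal.summable]
  have h2 : ∀ n : ℕ, ((n + 1 : ℕ) : ℝ≥0∞) * poissonMeasure r {n + 1} =
      r * poissonMeasure r {n} := by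
    intro n
    rw [poissonMeasure_singleton, poissonMeasure_singleton, ← ENNReal.ofReal_natCast,
      ← ENNReal.ofReal_coe_nnreal, ← ENNReal.ofReal_mul (by positivity),
      ← ENNReal.ofReal_mul (by positivity), Nat.factorial_succ]
    congr 1
    push_cast
    field_simp
    ring
  simp_rw [h2]
  rw [ENNReal.tsum_mul_left, h1]
  simp

/-- The reduced Campbell measure of a law of finite configurations: it integrates
`F (x, s \ {x})` summed over the points `x` of the configuration `s`. -/
def campbellMeasure (Q : Measure (Finset ℝ)) : Measure (ℝ × Finset ℝ) :=
  Measure.sum fun i : ℕ => (Q.restrict {s | i < s.card}).map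
    fun s => (ostat s i, s.erase (ostat s i))

theorem lintegral_campbellMeasure (Q : Measure (Finset ℝ)) {F : ℝ × Finset ℝ → ℝ≥0∞}
    (hF : Measurable F) :
    ∫⁻ p, F p ∂(campbellMeasure Q) = ∫⁻ s, ∑ x ∈ s, F (x, s.erase x) ∂Q := by
  have hm : ∀ i : ℕ, Measurable fun s : Finset ℝ => (ostat s i, s.erase (ostat s i)) := fun i =>
    (measurable_ostat i).prodMk (measurable_erase_ostat i)
  have hc : ∀ i : ℕ, MeasurableSet {s : Finset ℝ | i < s.card} := fun i =>
    measurable_card (measurableSet_Ioi (a := i))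
  rw [campbellMeasure, lintegral_sum_measure]
  simp_rw [lintegral_map hF (hm _), ← lintegral_indicator (hc _)]
  rw [← lintegral_tsum (f := fun (i : ℕ) => {s : Finset ℝ | i < s.card}.indicator
    fun s => F (ostat s i, s.erase (ostat s i)))
    fun i => ((hF.comp (hm i)).indicator (hc i)).aemeasurable]
  refine lintegral_congr fun s => ?_
  rw [sum_eq_sum_ostat, tsum_eq_sum (s := Finset.range s.card)]
  · refine Finset.sum_congr rfl fun i hi => ?_
    rw [Set.indicator_of_mem (by simpa using hi)]
  · intro i hi
    rw [Set.indicator_of_notMem (by simpa using hi)]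

/-- Removing a point `x ∈ B` empties `A` in two ways: `A` was already empty and `x ∈ B \ A`, or `x ∈
A ∩ B` was the only point in `A`. Each term on the right involves counts of disjoint sets only, so
independence applies. -/
theorem sum_indicator_prod_voidEvent (A B : Set ℝ) (s : Finset ℝ) :
    ∑ x ∈ s, (B ×ˢ voidEvent A).indicator (fun _ => (1 : ℝ≥0∞)) (x, s.erase x) =
      (cnt (B \ A) s : ℝ≥0∞) * Set.indicator {0} (fun _ => 1) (cnt A s) +
        Set.indicator {1} (fun _ => 1) (cnt (A ∩ B) s) *
          Set.indicator {0} (fun _ => 1) (cnt (A \ B) s) := by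
  have hsplit : cnt A s = cnt (A ∩ B) s + cnt (A \ B) s := by
    rw [cnt_eq_card_filter, cnt_eq_card_filter, cnt_eq_card_filter,
      ← Finset.card_union_of_disjoint]
    · congr 1
      ext x
      simp only [Finset.mem_filter, Finset.mem_union, Set.mem_inter_iff, Set.mem_sdiff]
      tauto
    · rw [Finset.disjoint_left]
      intro x hx hx'
      exact (Finset.mem_filter.1 hx').2.2 (Finset.mem_filter.1 hx).2.2
  have hterm : ∀ x ∈ s, (B ×ˢ voidEvent A).indicator (fun _ => (1 : ℝ≥0∞)) (x, s.erase x) =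
      (B \ A).indicator (fun _ => 1) x * Set.indicator {0} (fun _ => 1) (cnt A s) +
      (A ∩ B).indicator (fun _ => 1) x * Set.indicator {1} (fun _ => 1) (cnt A s) := by
    intro x hx
    have he := cnt_erase A s x hx
    have hpos : x ∈ A → cnt A s ≠ 0 := fun hA h0 => (cnt_eq_zero_iff A s).1 h0 x hx hA
    by_cases hB : x ∈ B <;> by_cases hA : x ∈ A
    · have := hpos hA
      by_cases h1 : cnt A s = 1
      · simp [Set.indicator, voidEvent, hA, hB, he, h1]
      · have h2 : cnt A s - 1 ≠ 0 := by omega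
        simp [Set.indicator, voidEvent, hA, hB, he, h1, this]
        omega
    · simp [Set.indicator, voidEvent, hA, hB, he]
    · simp [Set.indicator, hB]
    · simp [Set.indicator, hB]
  have hcount : ∀ D : Set ℝ, ∑ x ∈ s, D.indicator (fun _ => (1 : ℝ≥0∞)) x = cnt D s := by
    intro D
    rw [cnt_eq_card_filter, Finset.card_filter]
    simp [Set.indicator_apply]
  rw [Finset.sum_congr rfl hterm, Finset.sum_add_distrib, ← Finset.sum_mul, ← Finset.sum_mul,
    hcount, hcount]
  congr 1
  by_cases h1 : cnt A s = 1
  · rcases Nat.eq_zero_or_pos (cnt (A ∩ B) s) with h | h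
    · simp [h]
    · have h3 : cnt (A ∩ B) s = 1 := by omega
      have h4 : cnt (A \ B) s = 0 := by omega
      simp [h3, h4, h1]
  · by_cases h3 : cnt (A ∩ B) s = 1
    · have h4 : cnt (A \ B) s ≠ 0 := by omega
      simp [h1, h3, h4]
    · simp [h1, h3]

namespace IsUnitPoissonProcess

variable {Ω : Type u} [MeasurableSpace Ω] {P : Measure Ω} {L : ℝ} {Φ : Ω → Finset ℝ}

theorem measurable (h : IsUnitPoissonProcess P L Φ) : Measurable Φ :=
  measurable_of_measurable_cnt h.measurable_count

theorem measure_cnt_eq (h : IsUnitPoissonProcess P L Φ) {B : Set ℝ} (hB : MeasurableSet B)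
    (k : ℕ) : P {ω | cnt B (Φ ω) = k} =
      poissonMeasure (volume.restrict (Set.Icc 0 L) B).toNNReal {k} := by
  rw [Measure.restrict_apply hB, ← h.count_law B hB,
    Measure.map_apply (h.measurable_count B hB) (MeasurableSet.singleton k)]
  rfl

theorem lintegral_cnt (h : IsUnitPoissonProcess P L Φ) {B : Set ℝ} (hB : MeasurableSet B) :
    ∫⁻ ω, (cnt B (Φ ω) : ℝ≥0∞) ∂P = volume.restrict (Set.Icc 0 L) B := by
  have h1 := lintegral_map (μ := P) (f := fun n : ℕ => (n : ℝ≥0∞)) (g := pointCount Φ B)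
    (measurable_of_countable _) (h.measurable_count B hB)
  rw [h.count_law B hB, lintegral_natCast_poissonMeasure, ← Measure.restrict_apply hB,
    ENNReal.coe_toNNReal (measure_ne_top _ _)] at h1
  exact h1.symm

theorem lintegral_mul_cnt (h : IsUnitPoissonProcess P L Φ) {A B : Set ℝ} (hA : MeasurableSet A)
    (hB : MeasurableSet B) (hd : Disjoint A B) (f g : ℕ → ℝ≥0∞) :
    ∫⁻ ω, f (cnt A (Φ ω)) * g (cnt B (Φ ω)) ∂P =
      (∫⁻ ω, f (cnt A (Φ ω)) ∂P) * ∫⁻ ω, g (cnt B (Φ ω)) ∂P := by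
  have hi := h.count_indep 2 ![A, B] (by intro i; fin_cases i <;> simpa)
    (by
      intro i j hij
      fin_cases i <;> fin_cases j
      · exact absurd rfl hij
      · exact hd
      · exact hd.symm
      · exact absurd rfl hij)
  have h01 : IndepFun (pointCount Φ A) (pointCount Φ B) P :=
    hi.indepFun (i := 0) (j := 1) (by decide)
  have hfg := h01.comp (φ := f) (ψ := g) (measurable_of_countable _) (measurable_of_countable _)
  exact lintegral_mul_eq_lintegral_mul_lintegral_of_indepFun
    ((measurable_of_countable f).comp (h.measurable_count A hA))
    ((measurable_of_countable g).comp (h.measurable_count B hB)) hfg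

theorem lintegral_indicator_cnt (h : IsUnitPoissonProcess P L Φ) {B : Set ℝ}
    (hB : MeasurableSet B) (k : ℕ) :
    ∫⁻ ω, Set.indicator {k} (fun _ => (1 : ℝ≥0∞)) (cnt B (Φ ω)) ∂P =
      poissonMeasure (volume.restrict (Set.Icc 0 L) B).toNNReal {k} := by
  have hS : MeasurableSet {ω | cnt B (Φ ω) = k} :=
    h.measurable_count B hB (MeasurableSet.singleton k)
  rw [← h.measure_cnt_eq hB k, ← lintegral_indicator_one hS]
  rfl

theorem measure_voidEvent (h : IsUnitPoissonProcess P L Φ) {A : Set ℝ} (hA : MeasurableSet A) :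
    P.map Φ (voidEvent A) =
      ENNReal.ofReal (Real.exp (-(volume.restrict (Set.Icc 0 L) A).toReal)) := by
  rw [Measure.map_apply h.measurable (measurableSet_voidEvent hA)]
  refine (h.measure_cnt_eq hA 0).trans ?_
  rw [poissonMeasure_singleton]
  simp only [ENNReal.coe_toNNReal_eq_toReal, pow_zero, Nat.factorial_zero, Nat.cast_one, div_one,
    mul_one]

/-- With `ν` Lebesgue measure on `[0, L]`, the two cases contribute `ν(B \ A) e^{-ν(A)}` and `ν(A ∩
B) e^{-ν(A ∩ B)} e^{-ν(A \ B)}`, which add up to `ν(B) e^{-ν(A)}`. -/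
theorem campbellMeasure_rectangle (h : IsUnitPoissonProcess P L Φ) {A B : Set ℝ}
    (hA : MeasurableSet A) (hB : MeasurableSet B) :
    campbellMeasure (P.map Φ) (B ×ˢ voidEvent A) =
      volume.restrict (Set.Icc 0 L) B * P.map Φ (voidEvent A) := by
  have hR : MeasurableSet (B ×ˢ voidEvent A) := hB.prod (measurableSet_voidEvent hA)
  set ν : Measure ℝ := volume.restrict (Set.Icc 0 L) with hν
  rw [← lintegral_indicator_one hR]
  rw [show (B ×ˢ voidEvent A).indicator (1 : ℝ × Finset ℝ → ℝ≥0∞) =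
    (B ×ˢ voidEvent A).indicator fun _ => 1 from rfl,
    lintegral_campbellMeasure _ (measurable_const.indicator hR)]
  simp_rw [sum_indicator_prod_voidEvent]
  have hm : ∀ (f : ℕ → ℝ≥0∞) {D : Set ℝ}, MeasurableSet D →
      Measurable fun s : Finset ℝ => f (cnt D s) := fun f D hD =>
    (measurable_of_countable f).comp (measurable_cnt hD)
  have m1 : Measurable fun s : Finset ℝ =>
      (cnt (B \ A) s : ℝ≥0∞) * Set.indicator {0} (fun _ => 1) (cnt A s) :=
    (hm (fun n => n) (hB.diff hA)).mul (hm (Set.indicator {0} fun _ => 1) hA)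
  have m2 : Measurable fun s : Finset ℝ => Set.indicator {1} (fun _ => (1 : ℝ≥0∞)) (cnt (A ∩ B) s) *
      Set.indicator {0} (fun _ => 1) (cnt (A \ B) s) :=
    (hm (Set.indicator {1} fun _ => 1) (hA.inter hB)).mul
      (hm (Set.indicator {0} fun _ => 1) (hA.diff hB))
  rw [lintegral_add_left m1, lintegral_map m1 h.measurable, lintegral_map m2 h.measurable]
  rw [h.lintegral_mul_cnt (hB.diff hA) hA Set.disjoint_sdiff_left (fun n => (n : ℝ≥0∞)),
    h.lintegral_mul_cnt (hA.inter hB) (hA.diff hB)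
      (Set.disjoint_left.2 fun x hx hx' => hx'.2 hx.2),
    h.lintegral_cnt (hB.diff hA), h.lintegral_indicator_cnt hA, h.lintegral_indicator_cnt
    (hA.inter hB), h.lintegral_indicator_cnt (hA.diff hB), h.measure_voidEvent hA, ← hν]
  have hAB : ν A = ν (A ∩ B) + ν (A \ B) := (measure_inter_add_sdiff A hB).symm
  have hBA : ν B = ν (A ∩ B) + ν (B \ A) := by
    rw [Set.inter_comm, measure_inter_add_sdiff B hA]
  rw [hAB, hBA, poissonMeasure_singleton, poissonMeasure_singleton, poissonMeasure_singleton,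
    ← ENNReal.ofReal_mul (by positivity)]
  have hf1 : ν (A ∩ B) = ENNReal.ofReal (ν (A ∩ B)).toReal :=
    (ENNReal.ofReal_toReal (measure_ne_top _ _)).symm
  rw [ENNReal.toNNReal_add (measure_ne_top _ _) (measure_ne_top _ _),
    ENNReal.toReal_add (measure_ne_top _ _) (measure_ne_top _ _), add_mul,
    add_comm]
  congr 1
  · nth_rw 3 [hf1]
    rw [← ENNReal.ofReal_mul (by positivity)]
    congr 1
    simp only [ENNReal.coe_toNNReal_eq_toReal, pow_one, pow_zero, Nat.factorial_one,
      Nat.factorial_zero, Nat.cast_one, div_one, mul_one, neg_add, Real.exp_add]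
    ring
  · simp only [ENNReal.coe_toNNReal_eq_toReal, NNReal.coe_add, pow_zero, Nat.factorial_zero,
      Nat.cast_one, div_one, mul_one]

theorem campbellMeasure_eq [IsProbabilityMeasure P] (h : IsUnitPoissonProcess P L Φ) :
    campbellMeasure (P.map Φ) = (volume.restrict (Set.Icc 0 L)).prod (P.map Φ) := by
  have : IsProbabilityMeasure (P.map Φ) := Measure.isProbabilityMeasure_map h.measurable.aemeasurable
  symm
  refine Measure.prod_eq_generateFrom (C := {s | MeasurableSet s}) (D := voidEvents)
    MeasurableSpace.generateFrom_measurableSet generateFrom_voidEvents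
    MeasurableSpace.isPiSystem_measurableSet isPiSystem_voidEvents
    (Measure.toFiniteSpanningSetsIn _)
    -- The whole space is the avoidance event of `∅`, so the constant sequence is spanning.
    ⟨fun _ => Set.univ, fun _ => ⟨∅, MeasurableSet.empty, ?_⟩, fun _ => measure_lt_top _ _,
      Set.iUnion_const _⟩ ?_
  · ext s
    simp [voidEvent, cnt_eq_zero_iff]
  · rintro B hB _ ⟨A, hA, rfl⟩
    exact h.campbellMeasure_rectangle hA hB

/-- Mecke's formula for the Poisson process. -/
theorem mecke [IsProbabilityMeasure P] (h : IsUnitPoissonProcess P L Φ)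
    {F : ℝ × Finset ℝ → ℝ≥0∞} (hF : Measurable F) :
    ∫⁻ ω, ∑ x ∈ Φ ω, F (x, (Φ ω).erase x) ∂P =
      ∫⁻ x in Set.Icc 0 L, ∫⁻ ω, F (x, Φ ω) ∂P := by
  have : IsProbabilityMeasure (P.map Φ) := Measure.isProbabilityMeasure_map h.measurable.aemeasurable
  have hm : Measurable fun s : Finset ℝ => ∑ x ∈ s, F (x, s.erase x) :=
    measurable_sum_config (S := id) measurable_id (f := fun s x => F (x, s.erase x)) fun i =>
      hF.comp ((measurable_ostat i).prodMk (measurable_erase_ostat i))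
  rw [← lintegral_map (f := fun s => ∑ x ∈ s, F (x, s.erase x)) hm h.measurable,
    ← lintegral_campbellMeasure _ hF, h.campbellMeasure_eq, lintegral_prod _ hF.aemeasurable]
  refine lintegral_congr fun x => ?_
  exact lintegral_map (hF.comp measurable_prodMk_left) h.measurable

end IsUnitPoissonProcess

/-! ### The probability generating functional -/

theorem lintegral_eq_tsum_nat_fiber {α : Type*} [MeasurableSpace α] (μ : Measure α)
    {n : α → ℕ} (hn : Measurable n) (f : α → ℝ≥0∞) :
    ∫⁻ a, f a ∂μ = ∑' k, ∫⁻ a in {a | n a = k}, f a ∂μ := by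
  have hS : ∀ k, MeasurableSet {a | n a = k} := fun k => hn (MeasurableSet.singleton k)
  rw [← lintegral_iUnion hS, ← setLIntegral_univ]
  · congr 2
    ext a
    simp
  · intro i j hij
    refine Set.disjoint_left.2 fun a (ha : n a = i) (ha' : n a = j) => hij (ha.symm.trans ha')

namespace IsUnitPoissonProcess

variable {Ω : Type u} [MeasurableSpace Ω] {P : Measure Ω} {L : ℝ} {Φ : Ω → Finset ℝ}

theorem measurable_points (h : IsUnitPoissonProcess P L Φ) :
    Measurable fun ω => (Φ ω).card := measurable_card.comp h.measurable

/-- Mecke's formula for `v x · ∏ v` restricted to `n` remaining points: each of the `n + 1` points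
gives the same full product. The recursion yields the terms `e^{-L} (∫ v)^n / n!` of an exponential
series. -/
theorem setLIntegral_prod_succ [IsProbabilityMeasure P] (h : IsUnitPoissonProcess P L Φ)
    {v : ℝ → ℝ≥0∞} (hv : Measurable v) (n : ℕ) :
    ((n + 1 : ℕ) : ℝ≥0∞) * ∫⁻ ω in {ω | (Φ ω).card = n + 1}, ∏ x ∈ Φ ω, v x ∂P =
      (∫⁻ x in Set.Icc 0 L, v x) * ∫⁻ ω in {ω | (Φ ω).card = n}, ∏ x ∈ Φ ω, v x ∂P := by
  have hcard : ∀ k : ℕ, MeasurableSet {ω | (Φ ω).card = k} := fun k =>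
    h.measurable_points (MeasurableSet.singleton k)
  have hprod : Measurable fun s : Finset ℝ => ∏ x ∈ s, v x :=
    measurable_prod_config (S := id) measurable_id (f := fun _ x => v x)
      (hv.comp measurable_snd)
  have hF : Measurable fun p : ℝ × Finset ℝ =>
      v p.1 * Set.indicator {s | s.card = n} (fun s => ∏ x ∈ s, v x) p.2 :=
    (hv.comp measurable_fst).mul ((hprod.indicator
      (measurable_card (MeasurableSet.singleton n))).comp measurable_snd)
  have hM := h.mecke hF
  have hr : ∀ x : ℝ, ∫⁻ ω, v x * Set.indicator {s | s.card = n} (fun s => ∏ x ∈ s, v x) (Φ ω) ∂P =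
      v x * ∫⁻ ω in {ω | (Φ ω).card = n}, ∏ x ∈ Φ ω, v x ∂P := by
    intro x
    rw [← lintegral_indicator (hcard n)]
    exact lintegral_const_mul _ ((hprod.indicator
      (measurable_card (MeasurableSet.singleton n))).comp h.measurable)
  simp_rw [hr] at hM
  rw [lintegral_mul_const _ hv] at hM
  have hprodΦ : Measurable fun ω => ∏ x ∈ Φ ω, v x := hprod.comp h.measurable
  rw [← hM, ← lintegral_const_mul _ hprodΦ, ← lintegral_indicator (hcard _)]
  refine lintegral_congr fun ω => ?_
  have hs : ∀ x ∈ Φ ω, v x * Set.indicator {s : Finset ℝ | s.card = n}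
      (fun s => ∏ x ∈ s, v x) ((Φ ω).erase x) =
      if (Φ ω).card = n + 1 then ∏ y ∈ Φ ω, v y else 0 := by
    intro x hx
    have hpos : 0 < (Φ ω).card := Finset.card_pos.2 ⟨x, hx⟩
    have hc : ((Φ ω).erase x).card = n ↔ (Φ ω).card = n + 1 := by
      rw [Finset.card_erase_of_mem hx]
      omega
    simp only [Set.indicator, Set.mem_ofPred_eq, hc]
    split_ifs
    · exact Finset.mul_prod_erase _ _ hx
    · simp
  rw [Finset.sum_congr rfl hs, Finset.sum_const, nsmul_eq_mul]
  by_cases hc : (Φ ω).card = n + 1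
  · simp [hc]
  · simp [hc]

/-- The probability generating functional of the Poisson process. -/
theorem lintegral_prod [IsProbabilityMeasure P] (h : IsUnitPoissonProcess P L Φ) (hL : 0 ≤ L)
    {v : ℝ → ℝ≥0∞} (hv : Measurable v) (hfin : ∫⁻ x in Set.Icc 0 L, v x ≠ ∞) :
    ∫⁻ ω, ∏ x ∈ Φ ω, v x ∂P =
      ENNReal.ofReal (Real.exp ((∫⁻ x in Set.Icc 0 L, v x).toReal - L)) := by
  set U := ∫⁻ x in Set.Icc 0 L, v x with hU
  have hn : ∀ n : ℕ, ∫⁻ ω in {ω | (Φ ω).card = n}, ∏ x ∈ Φ ω, v x ∂P =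
      ENNReal.ofReal (Real.exp (-L) * (U.toReal ^ n / n.factorial)) := by
    intro n
    induction n with
    | zero =>
      have h0 : ∫⁻ ω in {ω | (Φ ω).card = 0}, ∏ x ∈ Φ ω, v x ∂P =
          ∫⁻ ω in {ω | (Φ ω).card = 0}, 1 ∂P := by
        refine setLIntegral_congr_fun (h.measurable_points (MeasurableSet.singleton 0)) ?_
        intro ω hω
        have : Φ ω = ∅ := Finset.card_eq_zero.1 hω
        simp [this]
      have h1 := h.measure_cnt_eq MeasurableSet.univ 0
      simp_rw [cnt_univ] at h1
      rw [h0, setLIntegral_one, h1, poissonMeasure_singleton]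
      rw [Measure.restrict_apply_univ, Real.volume_Icc, sub_zero,
        ENNReal.coe_toNNReal_eq_toReal, ENNReal.toReal_ofReal hL]
      simp
    | succ n ih =>
      have hs := h.setLIntegral_prod_succ hv n
      rw [ih, ← hU] at hs
      have hne : ((n + 1 : ℕ) : ℝ≥0∞) ≠ 0 := by simp
      rw [← ENNReal.mul_right_inj hne (ENNReal.natCast_ne_top _), hs,
        ← ENNReal.ofReal_toReal hfin, ← ENNReal.ofReal_natCast,
        ← ENNReal.ofReal_mul (by positivity), ← ENNReal.ofReal_mul (by positivity)]
      congr 1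
      rw [Nat.factorial_succ, ENNReal.ofReal_toReal hfin]
      push_cast
      field_simp
      ring
  rw [lintegral_eq_tsum_nat_fiber P h.measurable_points]
  simp_rw [hn]
  have hsum := (NormedSpace.expSeries_div_hasSum_exp (U.toReal)).mul_left (Real.exp (-L))
  rw [← ENNReal.ofReal_tsum_of_nonneg (fun n => by positivity) hsum.summable, hsum.tsum_eq,
    ← Real.exp_eq_exp_ℝ, ← Real.exp_add]
  congr 2
  ring

end IsUnitPoissonProcess

/-! ### Expected sums of products over nodes and over ordered pairs of nodes -/

namespace IsUnitPoissonProcess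

variable {Ω : Type u} [MeasurableSpace Ω] {P : Measure Ω} {L : ℝ} {Φ : Ω → Finset ℝ}

theorem lintegral_sum_prod_erase [IsProbabilityMeasure P] (h : IsUnitPoissonProcess P L Φ)
    (hL : 0 ≤ L) {w : ℝ → ℝ → ℝ≥0∞} (hw : Measurable (Function.uncurry w))
    (hw1 : ∀ x y, w x y ≤ 1) :
    ∫⁻ ω, ∑ x ∈ Φ ω, ∏ y ∈ (Φ ω).erase x, w x y ∂P =
      ∫⁻ x in Set.Icc 0 L,
        ENNReal.ofReal (Real.exp ((∫⁻ y in Set.Icc 0 L, w x y).toReal - L)) := by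
  have hF : Measurable fun p : ℝ × Finset ℝ => ∏ y ∈ p.2, w p.1 y :=
    measurable_prod_config (S := Prod.snd) measurable_snd (f := fun p y => w p.1 y)
      (hw.comp ((measurable_fst.comp measurable_fst).prodMk measurable_snd))
  rw [h.mecke hF]
  refine lintegral_congr fun x => h.lintegral_prod hL (hw.comp measurable_prodMk_left) ?_
  refine ne_top_of_le_ne_top (b := ∫⁻ y in Set.Icc 0 L, 1) (by simp) (lintegral_mono fun y => hw1 x y)

theorem lintegral_sum_sum_prod_erase [IsProbabilityMeasure P] (h : IsUnitPoissonProcess P L Φ)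
    (hL : 0 ≤ L) {w : ℝ → ℝ → ℝ≥0∞} (hw : Measurable (Function.uncurry w))
    (hw1 : ∀ x y, w x y ≤ 1) :
    ∫⁻ ω, ∑ x ∈ Φ ω, ∑ x' ∈ (Φ ω).erase x, (∏ y ∈ (Φ ω).erase x, w x y) *
        ∏ y ∈ ((Φ ω).erase x).erase x', w x' y ∂P =
      ∫⁻ x in Set.Icc 0 L, ∫⁻ x' in Set.Icc 0 L, w x x' *
        ENNReal.ofReal (Real.exp ((∫⁻ y in Set.Icc 0 L, w x y * w x' y).toReal - L)) := by
  have hF : Measurable fun p : ℝ × Finset ℝ =>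
      ∑ x' ∈ p.2, (∏ y ∈ p.2, w p.1 y) * ∏ y ∈ p.2.erase x', w x' y := by
    refine measurable_sum_config (S := Prod.snd) measurable_snd
      (f := fun p x' => (∏ y ∈ p.2, w p.1 y) * ∏ y ∈ p.2.erase x', w x' y) fun i => ?_
    refine Measurable.mul ?_ ?_
    · exact measurable_prod_config (S := Prod.snd) measurable_snd (f := fun p y => w p.1 y)
        (hw.comp ((measurable_fst.comp measurable_fst).prodMk measurable_snd))
    · exact measurable_prod_config (S := fun p : ℝ × Finset ℝ => p.2.erase (ostat p.2 i))
        ((measurable_erase_ostat i).comp measurable_snd) (f := fun p y => w (ostat p.2 i) y)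
        (hw.comp (((measurable_ostat i).comp (measurable_snd.comp measurable_fst)).prodMk
          measurable_snd))
  rw [h.mecke hF]
  refine lintegral_congr fun x => ?_
  have hG : Measurable fun p : ℝ × Finset ℝ => w x p.1 * ∏ y ∈ p.2, (w x y * w p.1 y) := by
    refine Measurable.mul ((hw.comp measurable_prodMk_left).comp measurable_fst) ?_
    exact measurable_prod_config (S := Prod.snd) measurable_snd
      (f := fun p y => w x y * w p.1 y)
      (((hw.comp measurable_prodMk_left).comp measurable_snd).mul
        (hw.comp ((measurable_fst.comp measurable_fst).prodMk measurable_snd)))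
  have hM := h.mecke hG
  -- The factor `w x x'` is split off so that the rest depends on `x'` and the configuration without
  -- `x'`, the form needed for the second use of Mecke's formula.
  have hl : ∀ ω, ∑ x' ∈ Φ ω, (∏ y ∈ Φ ω, w x y) * ∏ y ∈ (Φ ω).erase x', w x' y =
      ∑ x' ∈ Φ ω, w x x' * ∏ y ∈ (Φ ω).erase x', (w x y * w x' y) := by
    intro ω
    refine Finset.sum_congr rfl fun x' hx' => ?_
    rw [Finset.prod_mul_distrib, ← mul_assoc, Finset.mul_prod_erase _ (fun y => w x y) hx']
  simp_rw [hl]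
  rw [hM]
  refine lintegral_congr fun x' => ?_
  have hm : Measurable fun y => w x y * w x' y :=
    (hw.comp measurable_prodMk_left).mul (hw.comp measurable_prodMk_left)
  have hmp : Measurable fun ω => ∏ y ∈ Φ ω, (w x y * w x' y) :=
    measurable_prod_config h.measurable (f := fun _ y => w x y * w x' y)
      (hm.comp measurable_snd)
  dsimp only
  rw [lintegral_const_mul _ hmp, h.lintegral_prod hL hm ?_]
  refine ne_top_of_le_ne_top (b := ∫⁻ y in Set.Icc 0 L, 1) (by simp)
    (lintegral_mono fun y => mul_le_one' (hw1 x y) (hw1 x' y))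

end IsUnitPoissonProcess

/-! ### Connection probabilities and the conditional law of absent edges -/

theorem torusDist_nonneg {L x y : ℝ} (hx : x ∈ Set.Icc 0 L) (hy : y ∈ Set.Icc 0 L) :
    0 ≤ torusDist L x y := by
  refine le_min (abs_nonneg _) ?_
  have := abs_sub_le_iff.2 ⟨show x - y ≤ L by linarith [hx.2, hy.1],
    show y - x ≤ L by linarith [hx.1, hy.2]⟩
  linarith

theorem measurable_torusDist (L : ℝ) : Measurable fun p : ℝ × ℝ => torusDist L p.1 p.2 := by
  unfold torusDist
  fun_prop

/-- The connection probability of `x` and `y`. -/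
def connProb (H : ℝ → ℝ) (L x y : ℝ) : ℝ≥0∞ := ENNReal.ofReal (H (torusDist L x y))

theorem measurable_connProb {H : ℝ → ℝ} (hH : Measurable H) (L : ℝ) :
    Measurable (Function.uncurry (connProb H L)) :=
  (hH.comp (measurable_torusDist L)).ennreal_ofReal

theorem connProb_le_one {H : ℝ → ℝ} (hH : ∀ r : ℝ, 0 ≤ r → 0 ≤ H r ∧ H r ≤ 1) {L x y : ℝ}
    (hx : x ∈ Set.Icc 0 L) (hy : y ∈ Set.Icc 0 L) : connProb H L x y ≤ 1 :=
  ENNReal.ofReal_le_one.2 (hH _ (torusDist_nonneg hx hy)).2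

namespace IsSoftRGG

variable {Ω : Type u} [MeasurableSpace Ω] {P : Measure Ω} {L : ℝ} {H : ℝ → ℝ}
  {Φ : Ω → Finset ℝ} {G : Ω → SimpleGraph ℝ}

theorem configSigma_le (h : IsSoftRGG P L H Φ G) : configSigma Φ ≤ ‹MeasurableSpace Ω› := by
  rw [configSigma_eq_comap]
  exact h.nodes.measurable.comap_le

/-- Inclusion–exclusion one pair at a time: an absent edge `a` is the difference of the event
without a condition on `a` and the event with `a` present. The second event enlarges the set `T` of
present edges, so the induction on `S` keeps `T` arbitrary. -/
theorem measure_edges_nonedges [IsFiniteMeasure P] (h : IsSoftRGG P L H Φ G) (hH : Measurable H)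
    (hH1 : ∀ r : ℝ, 0 ≤ r → 0 ≤ H r ∧ H r ≤ 1) {ι : Type*} (x y : ι → Ω → ℝ) (A : Set Ω)
    (hA : MeasurableSet[configSigma Φ] A)
    (hx : ∀ i, Measurable[configSigma Φ] (x i)) (hy : ∀ i, Measurable[configSigma Φ] (y i))
    (U : Finset ι) (hmem : ∀ ω ∈ A, ∀ i ∈ U, x i ω ∈ Φ ω ∧ y i ω ∈ Φ ω ∧ x i ω ≠ y i ω)
    (hne : ∀ ω ∈ A, ∀ i ∈ U, ∀ j ∈ U, i ≠ j → s(x i ω, y i ω) ≠ s(x j ω, y j ω))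
    (S : Finset ι) : ∀ T : Finset ι, S ⊆ U → T ⊆ U → Disjoint S T →
    MeasurableSet {ω | ω ∈ A ∧ (∀ i ∈ T, (G ω).Adj (x i ω) (y i ω)) ∧
      ∀ i ∈ S, ¬ (G ω).Adj (x i ω) (y i ω)} ∧
    P {ω | ω ∈ A ∧ (∀ i ∈ T, (G ω).Adj (x i ω) (y i ω)) ∧
      ∀ i ∈ S, ¬ (G ω).Adj (x i ω) (y i ω)} =
      ∫⁻ ω in A, (∏ i ∈ T, connProb H L (x i ω) (y i ω)) *
        ∏ i ∈ S, (1 - connProb H L (x i ω) (y i ω)) ∂P := by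
  have hp : ∀ i, Measurable fun ω => connProb H L (x i ω) (y i ω) := fun i =>
    (measurable_connProb hH L).comp (((hx i).mono h.configSigma_le le_rfl).prodMk
      ((hy i).mono h.configSigma_le le_rfl))
  induction S using Finset.induction_on with
  | empty =>
    intro T _ hT _
    let e := T.equivFin
    have hE := h.edges T.card (fun k => x (e.symm k)) (fun k => y (e.symm k)) A hA
      (fun k => hx _) (fun k => hy _) (fun ω hω k => hmem ω hω _ (hT (e.symm k).2))
      (fun ω hω k l hkl => hne ω hω _ (hT (e.symm k).2) _ (hT (e.symm l).2) fun hc =>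
        hkl (e.symm.injective (Subtype.ext hc)))
    have hset : {ω | ω ∈ A ∧ (∀ i ∈ T, (G ω).Adj (x i ω) (y i ω)) ∧
        ∀ i ∈ (∅ : Finset ι), ¬ (G ω).Adj (x i ω) (y i ω)} =
        {ω | ω ∈ A ∧ ∀ k, (G ω).Adj (x (e.symm k) ω) (y (e.symm k) ω)} := by
      ext ω
      simp only [Finset.notMem_empty, false_imp_iff, imp_true_iff, and_true, Set.mem_ofPred_eq]
      refine and_congr_right fun _ => ⟨fun hh k => hh _ (e.symm k).2, fun hh i hi => ?_⟩
      simpa using hh (e ⟨i, hi⟩)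
    rw [hset]
    refine ⟨hE.1, hE.2.trans (lintegral_congr fun ω => ?_)⟩
    rw [Finset.prod_empty, mul_one, ← Finset.prod_coe_sort T]
    exact Equiv.prod_comp e.symm (fun i : T => connProb H L (x i ω) (y i ω))
  | insert a S ha ih =>
    intro T hS hT hd
    have haU : a ∈ U := hS (Finset.mem_insert_self a S)
    have haT : a ∉ T := Finset.disjoint_left.1 hd (Finset.mem_insert_self a S)
    have hSU : S ⊆ U := (Finset.subset_insert a S).trans hS
    have hST : Disjoint S T := Finset.disjoint_of_subset_left (Finset.subset_insert a S) hd
    obtain ⟨m1, e1⟩ := ih T hSU hT hST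
    obtain ⟨m2, e2⟩ := ih (insert a T) hSU (Finset.insert_subset haU hT)
      (Finset.disjoint_insert_right.2 ⟨ha, hST⟩)
    set E1 := {ω | ω ∈ A ∧ (∀ i ∈ T, (G ω).Adj (x i ω) (y i ω)) ∧
      ∀ i ∈ S, ¬ (G ω).Adj (x i ω) (y i ω)} with hE1
    set E2 := {ω | ω ∈ A ∧ (∀ i ∈ insert a T, (G ω).Adj (x i ω) (y i ω)) ∧
      ∀ i ∈ S, ¬ (G ω).Adj (x i ω) (y i ω)} with hE2
    have hset : {ω | ω ∈ A ∧ (∀ i ∈ T, (G ω).Adj (x i ω) (y i ω)) ∧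
        ∀ i ∈ insert a S, ¬ (G ω).Adj (x i ω) (y i ω)} = E1 \ E2 := by
      ext ω
      simp only [hE1, hE2, Finset.forall_mem_insert, Set.mem_sdiff, Set.mem_ofPred_eq]
      tauto
    have hsub : E2 ⊆ E1 := fun ω hω =>
      ⟨hω.1, fun i hi => hω.2.1 i (Finset.mem_insert_of_mem hi), hω.2.2⟩
    rw [hset]
    refine ⟨m1.diff m2, ?_⟩
    have hadd : P E2 + P (E1 \ E2) = P E1 := by
      have := measure_inter_add_sdiff (μ := P) E1 m2
      rwa [Set.inter_eq_right.2 hsub] at this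
    have hint : ∫⁻ ω in A, (∏ i ∈ T, connProb H L (x i ω) (y i ω)) *
        ∏ i ∈ S, (1 - connProb H L (x i ω) (y i ω)) ∂P =
        P E2 + ∫⁻ ω in A, (∏ i ∈ T, connProb H L (x i ω) (y i ω)) *
        ∏ i ∈ insert a S, (1 - connProb H L (x i ω) (y i ω)) ∂P := by
      rw [e2, ← lintegral_add_left]
      · refine setLIntegral_congr_fun (h.configSigma_le _ hA) fun ω hω => ?_
        obtain ⟨hxm, hym, -⟩ := hmem ω hω a haU
        have hle : connProb H L (x a ω) (y a ω) ≤ 1 :=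
          connProb_le_one hH1 (h.nodes.subset_Icc ω hxm) (h.nodes.subset_Icc ω hym)
        have hone : connProb H L (x a ω) (y a ω) + (1 - connProb H L (x a ω) (y a ω)) = 1 :=
          add_tsub_cancel_of_le hle
        rw [Finset.prod_insert ha, Finset.prod_insert haT]
        calc _ = ((∏ i ∈ T, connProb H L (x i ω) (y i ω)) *
              ∏ i ∈ S, (1 - connProb H L (x i ω) (y i ω))) *
              (connProb H L (x a ω) (y a ω) + (1 - connProb H L (x a ω) (y a ω))) := by
              rw [hone, mul_one]
          _ = _ := by ring
      · exact (Finset.measurable_fun_prod _ fun i _ => hp i).mul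
          (Finset.measurable_fun_prod _ fun i _ => measurable_const.sub (hp i))
    rw [e1, hint] at hadd
    exact (ENNReal.add_right_inj (measure_ne_top P E2)).1 hadd

end IsSoftRGG

/-! ### Isolated nodes as events about absent edges -/

theorem image_ostat_erase {s : Finset ℝ} {T : Finset ℕ} {i : ℕ}
    (hT : T ⊆ Finset.range s.card) (hi : i ∈ Finset.range s.card) :
    (T.erase i).image (ostat s) = (T.image (ostat s)).erase (ostat s i) := by
  ext x
  simp only [Finset.mem_image, Finset.mem_erase]
  constructor
  · rintro ⟨j, ⟨hji, hj⟩, rfl⟩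
    exact ⟨fun hc => hji (ostat_injOn s (Finset.mem_coe.2 (hT hj)) (Finset.mem_coe.2 hi) hc),
      j, hj, rfl⟩
  · rintro ⟨hne, j, hj, rfl⟩
    exact ⟨j, ⟨fun hc => hne (hc ▸ rfl), hj⟩, rfl⟩

theorem image_ostat_range_erase {s : Finset ℝ} {i : ℕ} (hi : i ∈ Finset.range s.card) :
    ((Finset.range s.card).erase i).image (ostat s) = s.erase (ostat s i) := by
  rw [image_ostat_erase subset_rfl hi, image_ostat]

theorem image_ostat_range_erase_erase {s : Finset ℝ} {i j : ℕ} (hi : i ∈ Finset.range s.card)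
    (hj : j ∈ Finset.range s.card) :
    (((Finset.range s.card).erase i).erase j).image (ostat s) =
      (s.erase (ostat s i)).erase (ostat s j) := by
  rw [image_ostat_erase (Finset.erase_subset _ _) hj, image_ostat_range_erase hi]

theorem ostat_ne {s : Finset ℝ} {i j : ℕ} (hi : i < s.card) (hj : j < s.card) (hij : i ≠ j) :
    ostat s i ≠ ostat s j := fun hc =>
  hij (ostat_injOn s (by simpa using hi) (by simpa using hj) hc)

/-- The node `x` has no edge to any other node. -/
def IsIsolatedNode (s : Finset ℝ) (g : SimpleGraph ℝ) (x : ℝ) : Prop :=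
  ∀ y ∈ s, y ≠ x → ¬ g.Adj x y

theorem isIsolatedNode_ostat_iff {s : Finset ℝ} {g : SimpleGraph ℝ} {i : ℕ} (hi : i < s.card) :
    IsIsolatedNode s g (ostat s i) ↔
      ∀ j ∈ (Finset.range s.card).erase i, ¬ g.Adj (ostat s i) (ostat s j) := by
  constructor
  · intro h j hj
    obtain ⟨hji, hj⟩ := Finset.mem_erase.1 hj
    have hj := Finset.mem_range.1 hj
    exact h _ (ostat_mem hj) (ostat_ne hj hi hji)
  · intro h y hy hne
    rw [← image_ostat s] at hy
    obtain ⟨j, hj, rfl⟩ := Finset.mem_image.1 hy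
    exact h j (Finset.mem_erase.2 ⟨fun hc => hne (hc ▸ rfl), hj⟩)

/-- The number of isolated nodes. -/
def isoCount (s : Finset ℝ) (g : SimpleGraph ℝ) : ℕ := (s.filter (IsIsolatedNode s g)).card

theorem numIsolated_eq {Ω : Type u} (Φ : Ω → Finset ℝ) (G : Ω → SimpleGraph ℝ) (ω : Ω) :
    numIsolated Φ G ω = isoCount (Φ ω) (G ω) := by
  rw [numIsolated, isoCount, ← Set.ncard_coe_finset]
  congr 2
  ext x
  simp [IsIsolatedNode]

theorem isoCount_eq_sum (s : Finset ℝ) (g : SimpleGraph ℝ) :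
    (isoCount s g : ℝ≥0∞) = ∑ x ∈ s, if IsIsolatedNode s g x then 1 else 0 := by
  rw [isoCount, Finset.card_filter]
  push_cast
  rfl

/-- The diagonal of the double sum is the count itself; the rest is the second factorial moment, to
which Mecke's formula applies. -/
theorem isoCount_sq_eq_sum (s : Finset ℝ) (g : SimpleGraph ℝ) :
    (isoCount s g : ℝ≥0∞) ^ 2 = isoCount s g + ∑ x ∈ s, ∑ x' ∈ s.erase x,
      if IsIsolatedNode s g x ∧ IsIsolatedNode s g x' then 1 else 0 := by
  rw [sq, isoCount_eq_sum, Finset.sum_mul, ← Finset.sum_add_distrib]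
  refine Finset.sum_congr rfl fun x hx => ?_
  rw [← Finset.add_sum_erase _ _ hx]
  by_cases h : IsIsolatedNode s g x
  · simp [h]
  · simp [h]

/-- The probability that `x` and `y` are not connected. -/
def nonConnProb (H : ℝ → ℝ) (L x y : ℝ) : ℝ≥0∞ := 1 - connProb H L x y

theorem measurable_nonConnProb {H : ℝ → ℝ} (hH : Measurable H) (L : ℝ) :
    Measurable (Function.uncurry (nonConnProb H L)) :=
  measurable_const.sub (measurable_connProb hH L)

theorem nonConnProb_le_one (H : ℝ → ℝ) (L x y : ℝ) : nonConnProb H L x y ≤ 1 := tsub_le_self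

namespace IsSoftRGG

variable {Ω : Type u} [MeasurableSpace Ω] {P : Measure Ω} {L : ℝ} {H : ℝ → ℝ}
  {Φ : Ω → Finset ℝ} {G : Ω → SimpleGraph ℝ}

theorem measurable_prod_erase_ostat {α : Type*} [MeasurableSpace α] {S : α → Finset ℝ}
    (hS : Measurable S) {w : ℝ → ℝ → ℝ≥0∞} (hw : Measurable (Function.uncurry w)) (i : ℕ) :
    Measurable fun a => ∏ y ∈ (S a).erase (ostat (S a) i), w (ostat (S a) i) y := by
  have h1 : Measurable fun a => (S a).erase (ostat (S a) i) := (measurable_erase_ostat i).comp hS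
  have h2 : Measurable fun a => ostat (S a) i := (measurable_ostat i).comp hS
  have h3 : Measurable fun p : α × ℝ => w (ostat (S p.1) i) p.2 :=
    hw.comp ((h2.comp measurable_fst).prodMk measurable_snd)
  exact measurable_prod_config h1 (f := fun a y => w (ostat (S a) i) y) h3

/-- Fixing the number `n` of nodes makes all ranks below `n` genuine nodes. The condition on
`p.swap` prevents an unordered pair from being listed twice. -/
theorem measure_nonedges_ostat [IsFiniteMeasure P] (h : IsSoftRGG P L H Φ G) (hH : Measurable H)
    (hH1 : ∀ r : ℝ, 0 ≤ r → 0 ≤ H r ∧ H r ≤ 1) (n : ℕ) (U : Finset (ℕ × ℕ))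
    (hU : ∀ p ∈ U, p.1 < n ∧ p.2 < n ∧ p.1 ≠ p.2 ∧ p.swap ∉ U) :
    MeasurableSet {ω | (Φ ω).card = n ∧
      ∀ p ∈ U, ¬ (G ω).Adj (ostat (Φ ω) p.1) (ostat (Φ ω) p.2)} ∧
    P {ω | (Φ ω).card = n ∧ ∀ p ∈ U, ¬ (G ω).Adj (ostat (Φ ω) p.1) (ostat (Φ ω) p.2)} =
      ∫⁻ ω in {ω | (Φ ω).card = n},
        ∏ p ∈ U, nonConnProb H L (ostat (Φ ω) p.1) (ostat (Φ ω) p.2) ∂P := by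
  have hΦ : Measurable[configSigma Φ] Φ := by
    rw [configSigma_eq_comap]
    exact comap_measurable Φ
  have hX : ∀ i, Measurable[configSigma Φ] fun ω => ostat (Φ ω) i := fun i =>
    (measurable_ostat i).comp hΦ
  have hA : MeasurableSet[configSigma Φ] {ω | (Φ ω).card = n} :=
    (measurable_card.comp hΦ) (MeasurableSet.singleton n)
  have := h.measure_edges_nonedges hH hH1 (fun (p : ℕ × ℕ) ω => ostat (Φ ω) p.1)
    (fun p ω => ostat (Φ ω) p.2) {ω | (Φ ω).card = n} hA (fun p => hX p.1) (fun p => hX p.2) U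
    ?_ ?_ U ∅ subset_rfl (Finset.empty_subset U) (Finset.disjoint_empty_right U)
  · simpa [nonConnProb] using this
  · rintro ω (hω : (Φ ω).card = n) p hp
    obtain ⟨h1, h2, h3, -⟩ := hU p hp
    rw [← hω] at h1 h2
    exact ⟨ostat_mem h1, ostat_mem h2, ostat_ne h1 h2 h3⟩
  · rintro ω (hω : (Φ ω).card = n) p hp q hq hpq hs
    obtain ⟨p1, p2, -, p4⟩ := hU p hp
    obtain ⟨q1, q2, -, -⟩ := hU q hq
    rw [← hω] at p1 p2 q1 q2
    have hinj : ∀ {i j : ℕ}, i < (Φ ω).card → j < (Φ ω).card →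
        ostat (Φ ω) i = ostat (Φ ω) j → i = j := fun hi hj hij => by
      by_contra hc
      exact ostat_ne hi hj hc hij
    rcases Sym2.eq_iff.1 hs with ⟨ha, hb⟩ | ⟨ha, hb⟩
    · exact hpq (Prod.ext (hinj p1 q1 ha) (hinj p2 q2 hb))
    · refine p4 ?_
      have : p.swap = q := Prod.ext (hinj p2 q1 hb) (hinj p1 q2 ha)
      rwa [this]

theorem measure_isolated [IsFiniteMeasure P] (h : IsSoftRGG P L H Φ G) (hH : Measurable H)
    (hH1 : ∀ r : ℝ, 0 ≤ r → 0 ≤ H r ∧ H r ≤ 1) {n i : ℕ} (hi : i < n) :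
    MeasurableSet {ω | (Φ ω).card = n ∧ IsIsolatedNode (Φ ω) (G ω) (ostat (Φ ω) i)} ∧
    P {ω | (Φ ω).card = n ∧ IsIsolatedNode (Φ ω) (G ω) (ostat (Φ ω) i)} =
      ∫⁻ ω in {ω | (Φ ω).card = n},
        ∏ y ∈ (Φ ω).erase (ostat (Φ ω) i), nonConnProb H L (ostat (Φ ω) i) y ∂P := by
  have hm := h.measure_nonedges_ostat hH hH1 n ({i} ×ˢ (Finset.range n).erase i) (by
    rintro ⟨a, b⟩ hp
    simp only [Finset.mem_product, Finset.mem_singleton, Finset.mem_erase, Finset.mem_range,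
      Prod.swap, not_and] at hp ⊢
    omega)
  have hset : {ω | (Φ ω).card = n ∧ IsIsolatedNode (Φ ω) (G ω) (ostat (Φ ω) i)} =
      {ω | (Φ ω).card = n ∧ ∀ p ∈ ({i} ×ˢ (Finset.range n).erase i : Finset (ℕ × ℕ)),
        ¬ (G ω).Adj (ostat (Φ ω) p.1) (ostat (Φ ω) p.2)} := by
    ext ω
    refine and_congr_right ?_
    rintro rfl
    rw [isIsolatedNode_ostat_iff hi]
    simp only [Finset.mem_product, Finset.mem_singleton, Prod.forall]
    exact ⟨fun hh a b hab => hab.1 ▸ hh b hab.2, fun hh b hb => hh i b ⟨rfl, hb⟩⟩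
  rw [hset]
  refine ⟨hm.1, hm.2.trans ?_⟩
  refine setLIntegral_congr_fun (h.nodes.measurable_points (MeasurableSet.singleton n)) ?_
  rintro ω (hω : (Φ ω).card = n)
  subst hω
  dsimp only
  rw [Finset.prod_product, Finset.prod_singleton,
    ← image_ostat_range_erase (Finset.mem_range.2 hi),
    Finset.prod_image ((ostat_injOn (Φ ω)).mono (Finset.coe_subset.2 (Finset.erase_subset _ _)))]

theorem measure_isolated_pair [IsFiniteMeasure P] (h : IsSoftRGG P L H Φ G) (hH : Measurable H)
    (hH1 : ∀ r : ℝ, 0 ≤ r → 0 ≤ H r ∧ H r ≤ 1) {n i j : ℕ} (hi : i < n) (hj : j < n)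
    (hij : i ≠ j) :
    MeasurableSet {ω | (Φ ω).card = n ∧ IsIsolatedNode (Φ ω) (G ω) (ostat (Φ ω) i) ∧
      IsIsolatedNode (Φ ω) (G ω) (ostat (Φ ω) j)} ∧
    P {ω | (Φ ω).card = n ∧ IsIsolatedNode (Φ ω) (G ω) (ostat (Φ ω) i) ∧
      IsIsolatedNode (Φ ω) (G ω) (ostat (Φ ω) j)} =
      ∫⁻ ω in {ω | (Φ ω).card = n},
        (∏ y ∈ (Φ ω).erase (ostat (Φ ω) i), nonConnProb H L (ostat (Φ ω) i) y) *
        ∏ y ∈ ((Φ ω).erase (ostat (Φ ω) i)).erase (ostat (Φ ω) j),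
          nonConnProb H L (ostat (Φ ω) j) y ∂P := by
  -- The pair `{i, j}` is listed only from the side of `i`; listing it twice would square its
  -- factor.
  set U : Finset (ℕ × ℕ) := {i} ×ˢ (Finset.range n).erase i ∪
    {j} ×ˢ ((Finset.range n).erase i).erase j with hU
  have hm := h.measure_nonedges_ostat hH hH1 n U (by
    rintro ⟨a, b⟩ hp
    simp only [hU, Finset.mem_union, Finset.mem_product, Finset.mem_singleton, Finset.mem_erase,
      Finset.mem_range, Prod.swap] at hp ⊢
    omega)
  have hset : {ω | (Φ ω).card = n ∧ IsIsolatedNode (Φ ω) (G ω) (ostat (Φ ω) i) ∧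
      IsIsolatedNode (Φ ω) (G ω) (ostat (Φ ω) j)} =
      {ω | (Φ ω).card = n ∧ ∀ p ∈ U, ¬ (G ω).Adj (ostat (Φ ω) p.1) (ostat (Φ ω) p.2)} := by
    ext ω
    refine and_congr_right ?_
    rintro rfl
    rw [isIsolatedNode_ostat_iff hi, isIsolatedNode_ostat_iff hj]
    simp only [hU, Finset.mem_union, Finset.mem_product, Finset.mem_singleton, Finset.mem_erase,
      Finset.mem_range, Prod.forall]
    constructor
    · rintro ⟨h1, h2⟩ a b (⟨rfl, hb⟩ | ⟨rfl, hb⟩)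
      · exact h1 b hb
      · exact h2 b ⟨hb.1, hb.2.2⟩
    · intro hall
      refine ⟨fun b hb => hall i b (Or.inl ⟨rfl, hb⟩), fun b hb => ?_⟩
      by_cases hbi : b = i
      · subst hbi
        exact fun hadj => hall b j (Or.inl ⟨rfl, fun hc => hij hc.symm, hj⟩) hadj.symm
      · exact hall j b (Or.inr ⟨rfl, hb.1, hbi, hb.2⟩)
  rw [hset]
  refine ⟨hm.1, hm.2.trans ?_⟩
  refine setLIntegral_congr_fun (h.nodes.measurable_points (MeasurableSet.singleton n)) ?_
  rintro ω (hω : (Φ ω).card = n)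
  subst hω
  dsimp only
  have hd : Disjoint ({i} ×ˢ (Finset.range (Φ ω).card).erase i : Finset (ℕ × ℕ))
      ({j} ×ˢ ((Finset.range (Φ ω).card).erase i).erase j) := by
    rw [Finset.disjoint_left]
    rintro ⟨a, b⟩ h1 h2
    simp only [Finset.mem_product, Finset.mem_singleton] at h1 h2
    exact hij (h1.1.symm.trans h2.1)
  rw [hU, Finset.prod_union hd, Finset.prod_product, Finset.prod_singleton, Finset.prod_product,
    Finset.prod_singleton, ← image_ostat_range_erase_erase (Finset.mem_range.2 hi)
      (Finset.mem_range.2 hj), ← image_ostat_range_erase (Finset.mem_range.2 hi),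
    Finset.prod_image ((ostat_injOn (Φ ω)).mono (Finset.coe_subset.2 (Finset.erase_subset _ _))),
    Finset.prod_image ((ostat_injOn (Φ ω)).mono (Finset.coe_subset.2
      ((Finset.erase_subset _ _).trans (Finset.erase_subset _ _))))]

theorem measurable_isoCount [IsFiniteMeasure P] (h : IsSoftRGG P L H Φ G) (hH : Measurable H)
    (hH1 : ∀ r : ℝ, 0 ≤ r → 0 ≤ H r ∧ H r ≤ 1) :
    Measurable fun ω => (isoCount (Φ ω) (G ω) : ℝ≥0∞) := by
  have hm := measurable_of_nat_index h.nodes.measurable_points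
    (g := fun n ω => ∑ i ∈ Finset.range n,
      {ω | (Φ ω).card = n ∧ IsIsolatedNode (Φ ω) (G ω) (ostat (Φ ω) i)}.indicator
        (fun _ => (1 : ℝ≥0∞)) ω)
    fun n => Finset.measurable_fun_sum _ fun i hi =>
      measurable_const.indicator (h.measure_isolated hH hH1 (Finset.mem_range.1 hi)).1
  convert! hm using 2 with ω
  rw [isoCount_eq_sum, sum_eq_sum_ostat]
  refine Finset.sum_congr rfl fun i _ => ?_
  simp [Set.indicator_apply]

theorem setLIntegral_indicator_one_of_subset {α : Type*} [MeasurableSpace α] {μ : Measure α}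
    {A B : Set α} (hB : MeasurableSet B) (hBA : B ⊆ A) :
    ∫⁻ a in A, B.indicator (fun _ => 1) a ∂μ = μ B := by
  rw [lintegral_indicator_const hB, one_mul, Measure.restrict_apply hB, Set.inter_eq_left.2 hBA]

theorem lintegral_isoCount_eq_prod [IsFiniteMeasure P] (h : IsSoftRGG P L H Φ G)
    (hH : Measurable H) (hH1 : ∀ r : ℝ, 0 ≤ r → 0 ≤ H r ∧ H r ≤ 1) :
    ∫⁻ ω, (isoCount (Φ ω) (G ω) : ℝ≥0∞) ∂P =
      ∫⁻ ω, ∑ x ∈ Φ ω, ∏ y ∈ (Φ ω).erase x, nonConnProb H L x y ∂P := by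
  rw [lintegral_eq_tsum_nat_fiber P h.nodes.measurable_points,
    lintegral_eq_tsum_nat_fiber P h.nodes.measurable_points]
  refine tsum_congr fun n => ?_
  have hA : MeasurableSet {ω | (Φ ω).card = n} :=
    h.nodes.measurable_points (MeasurableSet.singleton n)
  have hl : ∫⁻ ω in {ω | (Φ ω).card = n}, (isoCount (Φ ω) (G ω) : ℝ≥0∞) ∂P =
      ∫⁻ ω in {ω | (Φ ω).card = n}, ∑ i ∈ Finset.range n,
        {ω | (Φ ω).card = n ∧ IsIsolatedNode (Φ ω) (G ω) (ostat (Φ ω) i)}.indicator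
        (fun _ => (1 : ℝ≥0∞)) ω ∂P := by
    refine setLIntegral_congr_fun hA ?_
    rintro ω (rfl : (Φ ω).card = n)
    dsimp only
    rw [isoCount_eq_sum, sum_eq_sum_ostat]
    refine Finset.sum_congr rfl fun i _ => ?_
    simp [Set.indicator_apply]
  have hr : ∫⁻ ω in {ω | (Φ ω).card = n},
        ∑ x ∈ Φ ω, ∏ y ∈ (Φ ω).erase x, nonConnProb H L x y ∂P =
      ∫⁻ ω in {ω | (Φ ω).card = n}, ∑ i ∈ Finset.range n,
        ∏ y ∈ (Φ ω).erase (ostat (Φ ω) i), nonConnProb H L (ostat (Φ ω) i) y ∂P := by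
    refine setLIntegral_congr_fun hA ?_
    rintro ω (rfl : (Φ ω).card = n)
    exact sum_eq_sum_ostat _ _
  rw [hl, hr, lintegral_finsetSum _ fun i hi => measurable_const.indicator
    (h.measure_isolated hH hH1 (Finset.mem_range.1 hi)).1, lintegral_finsetSum _ fun i _ =>
      measurable_prod_erase_ostat h.nodes.measurable (measurable_nonConnProb hH L) i]
  refine Finset.sum_congr rfl fun i hi => ?_
  obtain ⟨h1, h2⟩ := h.measure_isolated hH hH1 (Finset.mem_range.1 hi)
  rw [← h2]
  exact setLIntegral_indicator_one_of_subset h1 fun ω hω => hω.1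

theorem lintegral_isolated_pairs_eq_prod [IsFiniteMeasure P] (h : IsSoftRGG P L H Φ G)
    (hH : Measurable H) (hH1 : ∀ r : ℝ, 0 ≤ r → 0 ≤ H r ∧ H r ≤ 1) :
    ∫⁻ ω, ∑ x ∈ Φ ω, ∑ x' ∈ (Φ ω).erase x, (if IsIsolatedNode (Φ ω) (G ω) x ∧
        IsIsolatedNode (Φ ω) (G ω) x' then (1 : ℝ≥0∞) else 0) ∂P =
      ∫⁻ ω, ∑ x ∈ Φ ω, ∑ x' ∈ (Φ ω).erase x, (∏ y ∈ (Φ ω).erase x, nonConnProb H L x y) *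
        ∏ y ∈ ((Φ ω).erase x).erase x', nonConnProb H L x' y ∂P := by
  rw [lintegral_eq_tsum_nat_fiber P h.nodes.measurable_points,
    lintegral_eq_tsum_nat_fiber P h.nodes.measurable_points]
  refine tsum_congr fun n => ?_
  have hA : MeasurableSet {ω | (Φ ω).card = n} :=
    h.nodes.measurable_points (MeasurableSet.singleton n)
  have hsum : ∀ (ω : Ω) (f : ℝ → ℝ → ℝ≥0∞), ∑ x ∈ Φ ω, ∑ x' ∈ (Φ ω).erase x, f x x' =
      ∑ i ∈ Finset.range (Φ ω).card, ∑ j ∈ (Finset.range (Φ ω).card).erase i,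
        f (ostat (Φ ω) i) (ostat (Φ ω) j) := by
    intro ω f
    rw [sum_eq_sum_ostat]
    refine Finset.sum_congr rfl fun i hi => ?_
    rw [← image_ostat_range_erase hi, Finset.sum_image
      ((ostat_injOn (Φ ω)).mono (Finset.coe_subset.2 (Finset.erase_subset _ _)))]
  have hl : ∫⁻ ω in {ω | (Φ ω).card = n}, ∑ x ∈ Φ ω, ∑ x' ∈ (Φ ω).erase x,
        (if IsIsolatedNode (Φ ω) (G ω) x ∧ IsIsolatedNode (Φ ω) (G ω) x' then (1 : ℝ≥0∞) else 0)
        ∂P =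
      ∫⁻ ω in {ω | (Φ ω).card = n}, ∑ i ∈ Finset.range n, ∑ j ∈ (Finset.range n).erase i,
        {ω | (Φ ω).card = n ∧ IsIsolatedNode (Φ ω) (G ω) (ostat (Φ ω) i) ∧
          IsIsolatedNode (Φ ω) (G ω) (ostat (Φ ω) j)}.indicator (fun _ => (1 : ℝ≥0∞)) ω ∂P := by
    refine setLIntegral_congr_fun hA ?_
    rintro ω (rfl : (Φ ω).card = n)
    dsimp only
    rw [hsum]
    refine Finset.sum_congr rfl fun i _ => Finset.sum_congr rfl fun j _ => ?_
    simp [Set.indicator_apply]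
  have hr : ∫⁻ ω in {ω | (Φ ω).card = n}, ∑ x ∈ Φ ω, ∑ x' ∈ (Φ ω).erase x,
        (∏ y ∈ (Φ ω).erase x, nonConnProb H L x y) *
        ∏ y ∈ ((Φ ω).erase x).erase x', nonConnProb H L x' y ∂P =
      ∫⁻ ω in {ω | (Φ ω).card = n}, ∑ i ∈ Finset.range n, ∑ j ∈ (Finset.range n).erase i,
        (∏ y ∈ (Φ ω).erase (ostat (Φ ω) i), nonConnProb H L (ostat (Φ ω) i) y) *
        ∏ y ∈ ((Φ ω).erase (ostat (Φ ω) i)).erase (ostat (Φ ω) j),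
          nonConnProb H L (ostat (Φ ω) j) y ∂P := by
    refine setLIntegral_congr_fun hA ?_
    rintro ω (rfl : (Φ ω).card = n)
    exact hsum ω fun x x' => (∏ y ∈ (Φ ω).erase x, nonConnProb H L x y) *
        ∏ y ∈ ((Φ ω).erase x).erase x', nonConnProb H L x' y
  have hpair : ∀ i ∈ Finset.range n, ∀ j ∈ (Finset.range n).erase i,
      MeasurableSet {ω | (Φ ω).card = n ∧ IsIsolatedNode (Φ ω) (G ω) (ostat (Φ ω) i) ∧
        IsIsolatedNode (Φ ω) (G ω) (ostat (Φ ω) j)} := fun i hi j hj =>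
    (h.measure_isolated_pair hH hH1 (Finset.mem_range.1 hi)
      (Finset.mem_range.1 (Finset.mem_of_mem_erase hj)) (Finset.ne_of_mem_erase hj).symm).1
  -- On the event of exactly `n` nodes the twice-erased product runs over a fixed set of ranks, and
  -- measurability there is all the restricted integral needs.
  have hE : ∀ i, i < n → ∀ j, j < n → Measurable ({ω | (Φ ω).card = n}.indicator fun ω =>
      ∏ y ∈ ((Φ ω).erase (ostat (Φ ω) i)).erase (ostat (Φ ω) j),
        nonConnProb H L (ostat (Φ ω) j) y) := by
    intro i hi j hj
    have : ({ω | (Φ ω).card = n}.indicator fun ω =>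
        ∏ y ∈ ((Φ ω).erase (ostat (Φ ω) i)).erase (ostat (Φ ω) j),
          nonConnProb H L (ostat (Φ ω) j) y) = {ω | (Φ ω).card = n}.indicator fun ω =>
        ∏ k ∈ ((Finset.range n).erase i).erase j,
          nonConnProb H L (ostat (Φ ω) j) (ostat (Φ ω) k) := by
      refine Set.indicator_congr ?_
      rintro ω (rfl : (Φ ω).card = n)
      dsimp only
      rw [← image_ostat_range_erase_erase (Finset.mem_range.2 hi) (Finset.mem_range.2 hj),
        Finset.prod_image ((ostat_injOn (Φ ω)).mono (Finset.coe_subset.2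
          ((Finset.erase_subset _ _).trans (Finset.erase_subset _ _))))]
    rw [this]
    exact (Finset.measurable_fun_prod _ fun k _ => (measurable_nonConnProb hH L).comp
      (((measurable_ostat j).comp h.nodes.measurable).prodMk
        ((measurable_ostat k).comp h.nodes.measurable))).indicator hA
  have hE' : ∀ i, i < n → ∀ j, j < n → AEMeasurable (fun ω =>
      ∏ y ∈ ((Φ ω).erase (ostat (Φ ω) i)).erase (ostat (Φ ω) j),
        nonConnProb H L (ostat (Φ ω) j) y) (P.restrict {ω | (Φ ω).card = n}) := fun i hi j hj =>
    (aemeasurable_indicator_iff hA).1 (hE i hi j hj).aemeasurable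
  have hprod : ∀ i ∈ Finset.range n, ∀ j ∈ (Finset.range n).erase i, AEMeasurable (fun ω =>
      (∏ y ∈ (Φ ω).erase (ostat (Φ ω) i), nonConnProb H L (ostat (Φ ω) i) y) *
        ∏ y ∈ ((Φ ω).erase (ostat (Φ ω) i)).erase (ostat (Φ ω) j),
          nonConnProb H L (ostat (Φ ω) j) y) (P.restrict {ω | (Φ ω).card = n}) := fun i hi j hj =>
    (measurable_prod_erase_ostat h.nodes.measurable
      (measurable_nonConnProb hH L) i).aemeasurable.mul
      (hE' i (Finset.mem_range.1 hi) j (Finset.mem_range.1 (Finset.mem_of_mem_erase hj)))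
  rw [hl, hr, lintegral_finsetSum _ fun i hi => Finset.measurable_fun_sum _ fun j hj =>
    measurable_const.indicator (hpair i hi j hj), lintegral_finsetSum' _ fun i hi =>
      Finset.aemeasurable_fun_sum _ fun j hj => hprod i hi j hj]
  refine Finset.sum_congr rfl fun i hi => ?_
  rw [lintegral_finsetSum _ fun j hj => measurable_const.indicator (hpair i hi j hj),
    lintegral_finsetSum' _ fun j hj => hprod i hi j hj]
  refine Finset.sum_congr rfl fun j hj => ?_
  rw [← (h.measure_isolated_pair hH hH1 (Finset.mem_range.1 hi)
      (Finset.mem_range.1 (Finset.mem_of_mem_erase hj)) (Finset.ne_of_mem_erase hj).symm).2]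
  exact setLIntegral_indicator_one_of_subset (hpair i hi j hj) fun ω hω => hω.1

end IsSoftRGG

/-! ### Integrals of the connection probability over the torus -/

/-- The connection function periodised: `H` at the distance of `r` from `0` on the torus. -/
def periodicConn (H : ℝ → ℝ) (L r : ℝ) : ℝ := H (min |r| (L - |r|))

theorem intervalIntegrable_periodicConn {H : ℝ → ℝ} (hH : Measurable H)
    (hH1 : ∀ r : ℝ, 0 ≤ r → 0 ≤ H r ∧ H r ≤ 1) {L a b : ℝ} (ha : |a| ≤ L) (hb : |b| ≤ L) :
    IntervalIntegrable (periodicConn H L) volume a b := by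
  have hm : Measurable (periodicConn H L) := hH.comp (by fun_prop)
  rw [intervalIntegrable_iff]
  refine Measure.integrableOn_of_bounded (M := 1) (by simp) hm.aestronglyMeasurable ?_
  refine (ae_restrict_iff' measurableSet_uIoc).2 (Eventually.of_forall fun r hr => ?_)
  have hr' : |r| ≤ L := by
    have h1 := Set.uIoc_subset_uIcc hr
    rw [Set.mem_uIcc] at h1
    rw [abs_le] at *
    rcases h1 with h1 | h1 <;> constructor <;> linarith
  have h2 := hH1 (min |r| (L - |r|)) (le_min (abs_nonneg _) (by linarith))
  rw [Real.norm_eq_abs, abs_le]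
  exact ⟨by linarith [h2.1, show periodicConn H L r = H (min |r| (L - |r|)) from rfl], h2.2⟩

theorem integral_periodicConn {H : ℝ → ℝ} (hH : Measurable H)
    (hH1 : ∀ r : ℝ, 0 ≤ r → 0 ≤ H r ∧ H r ≤ 1) {L : ℝ} (hL : 0 ≤ L) :
    ∫ r in (0 : ℝ)..L, periodicConn H L r = 2 * ∫ r in (0 : ℝ)..(L / 2), H r := by
  have hii : ∀ a b : ℝ, |a| ≤ L → |b| ≤ L → IntervalIntegrable (periodicConn H L) volume a b :=
    fun a b => intervalIntegrable_periodicConn hH hH1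
  have h2 : |L / 2| ≤ L := by rw [abs_of_nonneg (by linarith)]; linarith
  rw [← intervalIntegral.integral_add_adjacent_intervals
    (hii 0 (L / 2) (by simpa using hL) h2) (hii (L / 2) L h2 (abs_of_nonneg hL).le)]
  have e1 : ∫ r in (0 : ℝ)..(L / 2), periodicConn H L r = ∫ r in (0 : ℝ)..(L / 2), H r := by
    refine intervalIntegral.integral_congr fun r hr => ?_
    rw [Set.uIcc_of_le (by linarith)] at hr
    simp only [periodicConn]
    rw [abs_of_nonneg hr.1, min_eq_left (by linarith [hr.2])]
  have e2 : ∫ r in (L / 2)..L, periodicConn H L r = ∫ r in (0 : ℝ)..(L / 2), H r := by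
    have h3 := intervalIntegral.integral_comp_sub_left (periodicConn H L) L (a := L / 2) (b := L)
    rw [sub_self, sub_half, e1] at h3
    rw [← h3]
    refine intervalIntegral.integral_congr fun r hr => ?_
    rw [Set.uIcc_of_le (by linarith)] at hr
    simp only [periodicConn]
    rw [abs_of_nonneg (show 0 ≤ r by linarith [hr.1]),
      abs_of_nonneg (show 0 ≤ L - r by linarith [hr.2]), sub_sub_cancel, min_comm]
  rw [e1, e2]
  ring

/-- Translation invariance of the torus: substitution gives the interval `[x - L, x]`, whose
negative part is moved by one period onto `[x, L]`. Reflection `r ↦ L - r` then gives the factor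
`2`. -/
theorem integral_torusDist {H : ℝ → ℝ} (hH : Measurable H)
    (hH1 : ∀ r : ℝ, 0 ≤ r → 0 ≤ H r ∧ H r ≤ 1) {L x : ℝ} (hx : x ∈ Set.Icc 0 L) :
    ∫ y in (0 : ℝ)..L, H (torusDist L x y) = 2 * ∫ r in (0 : ℝ)..(L / 2), H r := by
  have hL : 0 ≤ L := hx.1.trans hx.2
  have hii : ∀ a b : ℝ, |a| ≤ L → |b| ≤ L → IntervalIntegrable (periodicConn H L) volume a b :=
    fun a b => intervalIntegrable_periodicConn hH hH1
  have h0 : |(0 : ℝ)| ≤ L := by simpa using hL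
  have hx' : |x| ≤ L := by rw [abs_of_nonneg hx.1]; exact hx.2
  have hxL : |x - L| ≤ L := by rw [abs_le]; constructor <;> linarith [hx.1, hx.2]
  have e0 := intervalIntegral.integral_comp_sub_left (periodicConn H L) x (a := 0) (b := L)
  rw [sub_zero] at e0
  refine Eq.trans e0 ?_
  rw [← intervalIntegral.integral_add_adjacent_intervals (hii (x - L) 0 hxL h0) (hii 0 x h0 hx')]
  have e1 := intervalIntegral.integral_comp_sub_right (periodicConn H L) L (a := x) (b := L)
  rw [sub_self] at e1
  have e2 : ∫ r in x..L, periodicConn H L (r - L) = ∫ r in x..L, periodicConn H L r := by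
    refine intervalIntegral.integral_congr fun r hr => ?_
    rw [Set.uIcc_of_le hx.2] at hr
    simp only [periodicConn]
    rw [abs_sub_comm r L, abs_of_nonneg (show 0 ≤ r by linarith [hr.1, hx.1]),
      abs_of_nonneg (show 0 ≤ L - r by linarith [hr.2]), sub_sub_cancel, min_comm]
  rw [← e1, e2, add_comm, intervalIntegral.integral_add_adjacent_intervals (hii 0 x h0 hx')
    (hii x L hx' (abs_of_nonneg hL).le)]
  exact integral_periodicConn hH hH1 hL

theorem connProb_comm (H : ℝ → ℝ) (L x y : ℝ) : connProb H L x y = connProb H L y x := by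
  rw [connProb, connProb, torusDist, torusDist, abs_sub_comm]

theorem lintegral_connProb {H : ℝ → ℝ} (hH : Measurable H)
    (hH1 : ∀ r : ℝ, 0 ≤ r → 0 ≤ H r ∧ H r ≤ 1) {L x : ℝ} (hx : x ∈ Set.Icc 0 L) :
    ∫⁻ y in Set.Icc 0 L, connProb H L x y =
      ENNReal.ofReal (2 * ∫ r in (0 : ℝ)..(L / 2), H r) := by
  have hm : Measurable fun y => H (torusDist L x y) :=
    hH.comp ((measurable_torusDist L).comp measurable_prodMk_left)
  have hb : ∀ y ∈ Set.Icc 0 L, 0 ≤ H (torusDist L x y) ∧ H (torusDist L x y) ≤ 1 := fun y hy =>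
    hH1 _ (torusDist_nonneg hx hy)
  rw [← integral_torusDist hH hH1 hx, intervalIntegral.integral_of_le (hx.1.trans hx.2),
    ← integral_Icc_eq_integral_Ioc, ofReal_integral_eq_lintegral_ofReal]
  · rfl
  · refine Measure.integrableOn_of_bounded (M := 1) (by simp) hm.aestronglyMeasurable ?_
    refine (ae_restrict_iff' measurableSet_Icc).2 (Eventually.of_forall fun y hy => ?_)
    rw [Real.norm_eq_abs, abs_of_nonneg (hb y hy).1]
    exact (hb y hy).2
  · exact (ae_restrict_iff' measurableSet_Icc).2 (Eventually.of_forall fun y hy => (hb y hy).1)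

theorem halfIntegral_nonneg {H : ℝ → ℝ} (hH1 : ∀ r : ℝ, 0 ≤ r → 0 ≤ H r ∧ H r ≤ 1) {L : ℝ}
    (hL : 0 ≤ L) : 0 ≤ ∫ r in (0 : ℝ)..(L / 2), H r :=
  intervalIntegral.integral_nonneg (by linarith) fun r hr => (hH1 r hr.1).1

theorem connProb_add_nonConnProb {H : ℝ → ℝ} (hH1 : ∀ r : ℝ, 0 ≤ r → 0 ≤ H r ∧ H r ≤ 1)
    {L x y : ℝ} (hx : x ∈ Set.Icc 0 L) (hy : y ∈ Set.Icc 0 L) :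
    connProb H L x y + nonConnProb H L x y = 1 := by
  rw [nonConnProb]
  exact add_tsub_cancel_of_le (connProb_le_one hH1 hx hy)

/-- The left side is the exponent of the generating functional. It is found from an additive
identity in `ℝ≥0∞`, which avoids truncated subtraction. -/
theorem lintegral_nonConnProb {H : ℝ → ℝ} (hH : Measurable H)
    (hH1 : ∀ r : ℝ, 0 ≤ r → 0 ≤ H r ∧ H r ≤ 1) {L x : ℝ} (hx : x ∈ Set.Icc 0 L) :
    (∫⁻ y in Set.Icc 0 L, nonConnProb H L x y).toReal - L =
      -(2 * ∫ r in (0 : ℝ)..(L / 2), H r) := by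
  have hL : 0 ≤ L := hx.1.trans hx.2
  have hI := halfIntegral_nonneg hH1 hL
  have hcp := lintegral_connProb hH hH1 hx
  generalize (∫ r in (0 : ℝ)..(L / 2), H r) = I at hI hcp ⊢
  have hm : Measurable fun y => nonConnProb H L x y :=
    (measurable_nonConnProb hH L).of_uncurry_left
  have hadd : (∫⁻ y in Set.Icc 0 L, nonConnProb H L x y) +
      ENNReal.ofReal (2 * I) = ENNReal.ofReal L := by
    rw [← hcp, ← lintegral_add_left hm]
    have : ∫⁻ y in Set.Icc 0 L, (nonConnProb H L x y + connProb H L x y) =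
        ∫⁻ _y in Set.Icc 0 L, 1 :=
      setLIntegral_congr_fun measurableSet_Icc fun y hy => by
        rw [add_comm]
        exact connProb_add_nonConnProb hH1 hx hy
    rw [this]
    simp
  have h1 : ∫⁻ y in Set.Icc 0 L, nonConnProb H L x y ≠ ∞ :=
    ne_top_of_le_ne_top ENNReal.ofReal_ne_top (le_self_add.trans_eq hadd)
  have h2 := congrArg ENNReal.toReal hadd
  rw [ENNReal.toReal_add h1 ENNReal.ofReal_ne_top, ENNReal.toReal_ofReal (by positivity),
    ENNReal.toReal_ofReal hL] at h2
  linarith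

/-- The expected number of common neighbours of `x` and `x'`. -/
def commonConn (H : ℝ → ℝ) (L x x' : ℝ) : ℝ≥0∞ :=
  ∫⁻ y in Set.Icc 0 L, connProb H L x y * connProb H L x' y

theorem commonConn_le {H : ℝ → ℝ} (hH : Measurable H)
    (hH1 : ∀ r : ℝ, 0 ≤ r → 0 ≤ H r ∧ H r ≤ 1) {L x x' : ℝ} (hx : x ∈ Set.Icc 0 L)
    (hx' : x' ∈ Set.Icc 0 L) :
    commonConn H L x x' ≤ ENNReal.ofReal (2 * ∫ r in (0 : ℝ)..(L / 2), H r) := by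
  rw [← lintegral_connProb hH hH1 hx]
  exact setLIntegral_mono' measurableSet_Icc fun y hy =>
    mul_le_of_le_one_right' (connProb_le_one hH1 hx' hy)

/-- Integrate `(1 - p)(1 - p') + p + p' = 1 + p p'`, again kept free of subtraction. -/
theorem lintegral_nonConnProb_mul {H : ℝ → ℝ} (hH : Measurable H)
    (hH1 : ∀ r : ℝ, 0 ≤ r → 0 ≤ H r ∧ H r ≤ 1) {L x x' : ℝ} (hx : x ∈ Set.Icc 0 L)
    (hx' : x' ∈ Set.Icc 0 L) :
    (∫⁻ y in Set.Icc 0 L, nonConnProb H L x y * nonConnProb H L x' y).toReal - L =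
      -(4 * ∫ r in (0 : ℝ)..(L / 2), H r) + (commonConn H L x x').toReal := by
  have hL : 0 ≤ L := hx.1.trans hx.2
  have hI := halfIntegral_nonneg hH1 hL
  have hcp := lintegral_connProb hH hH1 hx
  have hcp' := lintegral_connProb hH hH1 hx'
  have hw : ∀ z, Measurable fun y => nonConnProb H L z y := fun z =>
    (measurable_nonConnProb hH L).of_uncurry_left
  have hp : ∀ z, Measurable fun y => connProb H L z y := fun z =>
    (measurable_connProb hH L).of_uncurry_left
  have hc : commonConn H L x x' ≠ ∞ :=
    ne_top_of_le_ne_top ENNReal.ofReal_ne_top (commonConn_le hH hH1 hx hx')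
  generalize (∫ r in (0 : ℝ)..(L / 2), H r) = I at hI hcp hcp' ⊢
  have hww : Measurable fun y => nonConnProb H L x y * nonConnProb H L x' y :=
    (hw x).mul (hw x')
  have hadd : (∫⁻ y in Set.Icc 0 L, nonConnProb H L x y * nonConnProb H L x' y) +
      (ENNReal.ofReal (2 * I) +
      ENNReal.ofReal (2 * I)) =
      ENNReal.ofReal L + commonConn H L x x' := by
    nth_rw 1 [← hcp]
    rw [← hcp', ← lintegral_add_left (hp x),
      ← lintegral_add_left hww, commonConn]
    have : ENNReal.ofReal L = ∫⁻ _y in Set.Icc 0 L, 1 := by simp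
    rw [this, ← lintegral_add_left measurable_const]
    refine setLIntegral_congr_fun measurableSet_Icc fun y hy => ?_
    have h1 : connProb H L x y + nonConnProb H L x y = 1 :=
      connProb_add_nonConnProb hH1 hx hy
    have h2 : connProb H L x' y + nonConnProb H L x' y = 1 :=
      connProb_add_nonConnProb hH1 hx' hy
    calc _ = nonConnProb H L x y * nonConnProb H L x' y +
          (connProb H L x y * (connProb H L x' y + nonConnProb H L x' y) +
          (connProb H L x y + nonConnProb H L x y) * connProb H L x' y) := by
          rw [h1, h2, mul_one, one_mul]
      _ = (connProb H L x y + nonConnProb H L x y) * (connProb H L x' y + nonConnProb H L x' y) +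
          connProb H L x y * connProb H L x' y := by ring
      _ = _ := by rw [h1, h2, mul_one]
  have h1 : ∫⁻ y in Set.Icc 0 L, nonConnProb H L x y * nonConnProb H L x' y ≠ ∞ :=
    ne_top_of_le_ne_top (ENNReal.add_ne_top.2 ⟨ENNReal.ofReal_ne_top, hc⟩) (le_self_add.trans_eq hadd)
  have h2 := congrArg ENNReal.toReal hadd
  rw [ENNReal.toReal_add h1 (ENNReal.add_ne_top.2 ⟨ENNReal.ofReal_ne_top, ENNReal.ofReal_ne_top⟩),
    ENNReal.toReal_add ENNReal.ofReal_ne_top ENNReal.ofReal_ne_top,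
    ENNReal.toReal_ofReal (by positivity), ENNReal.toReal_add ENNReal.ofReal_ne_top hc,
    ENNReal.toReal_ofReal hL] at h2
  linarith

/-- By Tonelli the common neighbour `y` is integrated last, and each endpoint contributes `2 I`
whatever `y` is. The result is linear in `L`, which is why the correlation term is of order `1 / L`
after normalisation. -/
theorem lintegral_lintegral_commonConn {H : ℝ → ℝ} (hH : Measurable H)
    (hH1 : ∀ r : ℝ, 0 ≤ r → 0 ≤ H r ∧ H r ≤ 1) {L : ℝ} (hL : 0 ≤ L) :
    ∫⁻ x in Set.Icc 0 L, ∫⁻ x' in Set.Icc 0 L, commonConn H L x x' =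
      ENNReal.ofReal (L * (2 * ∫ r in (0 : ℝ)..(L / 2), H r) ^ 2) := by
  have hI := halfIntegral_nonneg hH1 hL
  have hp := measurable_connProb hH L
  have key : ∀ x ∈ Set.Icc 0 L, ∫⁻ x' in Set.Icc 0 L, commonConn H L x x' =
      ENNReal.ofReal ((2 * ∫ r in (0 : ℝ)..(L / 2), H r) ^ 2) := by
    intro x hx
    unfold commonConn
    rw [lintegral_lintegral_swap]
    · have h1 : ∀ y ∈ Set.Icc 0 L, ∫⁻ x' in Set.Icc 0 L, connProb H L x y * connProb H L x' y =
          connProb H L x y * ENNReal.ofReal (2 * ∫ r in (0 : ℝ)..(L / 2), H r) := by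
        intro y hy
        have hpy : Measurable fun x' => connProb H L x' y := hp.of_uncurry_right
        rw [lintegral_const_mul _ hpy]
        simp_rw [fun x' => connProb_comm H L x' y]
        rw [lintegral_connProb hH hH1 hy]
      have hpx : Measurable fun y => connProb H L x y := hp.of_uncurry_left
      rw [setLIntegral_congr_fun measurableSet_Icc h1,
        lintegral_mul_const _ hpx, lintegral_connProb hH hH1 hx,
        ← ENNReal.ofReal_mul (by positivity), sq]
    · exact ((hp.comp (measurable_const.prodMk measurable_snd)).mul hp).aemeasurable
  rw [setLIntegral_congr_fun measurableSet_Icc key, setLIntegral_const, Real.volume_Icc,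
    sub_zero, ← ENNReal.ofReal_mul (by positivity), mul_comm]

/-! ### First and second factorial moments -/

namespace IsSoftRGG

variable {Ω : Type u} [MeasurableSpace Ω] {P : Measure Ω} {L : ℝ} {H : ℝ → ℝ}
  {Φ : Ω → Finset ℝ} {G : Ω → SimpleGraph ℝ}

theorem lintegral_isoCount [IsProbabilityMeasure P] (h : IsSoftRGG P L H Φ G) (hL : 0 ≤ L)
    (hH : Measurable H) (hH1 : ∀ r : ℝ, 0 ≤ r → 0 ≤ H r ∧ H r ≤ 1) :
    ∫⁻ ω, (isoCount (Φ ω) (G ω) : ℝ≥0∞) ∂P =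
      ENNReal.ofReal (L * Real.exp (-2 * ∫ r in (0 : ℝ)..(L / 2), H r)) := by
  rw [h.lintegral_isoCount_eq_prod hH hH1, h.nodes.lintegral_sum_prod_erase hL
    (measurable_nonConnProb hH L) (nonConnProb_le_one H L)]
  have key : ∀ x ∈ Set.Icc 0 L, ENNReal.ofReal (Real.exp
      ((∫⁻ y in Set.Icc 0 L, nonConnProb H L x y).toReal - L)) =
      ENNReal.ofReal (Real.exp (-2 * ∫ r in (0 : ℝ)..(L / 2), H r)) := by
    intro x hx
    rw [lintegral_nonConnProb hH hH1 hx, neg_mul]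
  rw [setLIntegral_congr_fun measurableSet_Icc key, setLIntegral_const, Real.volume_Icc,
    sub_zero, ← ENNReal.ofReal_mul (by positivity), mul_comm]

theorem lintegral_isolated_pairs_le [IsProbabilityMeasure P] (h : IsSoftRGG P L H Φ G)
    (hL : 0 ≤ L) (hH : Measurable H) (hH1 : ∀ r : ℝ, 0 ≤ r → 0 ≤ H r ∧ H r ≤ 1) {c : ℝ}
    (hc : 2 * ∫ r in (0 : ℝ)..(L / 2), H r ≤ c) :
    ∫⁻ ω, ∑ x ∈ Φ ω, ∑ x' ∈ (Φ ω).erase x, (if IsIsolatedNode (Φ ω) (G ω) x ∧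
        IsIsolatedNode (Φ ω) (G ω) x' then (1 : ℝ≥0∞) else 0) ∂P ≤
      ENNReal.ofReal (Real.exp (-(4 * ∫ r in (0 : ℝ)..(L / 2), H r)) *
        (L ^ 2 + Real.exp c * (L * (2 * ∫ r in (0 : ℝ)..(L / 2), H r) ^ 2))) := by
  have hI := halfIntegral_nonneg hH1 hL
  set I := ∫ r in (0 : ℝ)..(L / 2), H r with hIdef
  rw [h.lintegral_isolated_pairs_eq_prod hH hH1, h.nodes.lintegral_sum_sum_prod_erase hL
    (measurable_nonConnProb hH L) (nonConnProb_le_one H L)]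
  -- Multiply `1 - t ≤ exp (-t)` by `exp t`, then bound `exp t` by `exp c` in the linear term.
  have hexp : ∀ t : ℝ, 0 ≤ t → t ≤ c → Real.exp t ≤ 1 + Real.exp c * t := by
    intro t ht htc
    have h1 := Real.add_one_le_exp (-t)
    have h2 : Real.exp t * Real.exp (-t) = 1 := by rw [← Real.exp_add]; simp
    have h3 := mul_le_mul_of_nonneg_left h1 (Real.exp_nonneg t)
    rw [h2] at h3
    have h4 : Real.exp t * t ≤ Real.exp c * t :=
      mul_le_mul_of_nonneg_right (Real.exp_le_exp.2 htc) ht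
    linarith
  have key : ∀ x ∈ Set.Icc 0 L, ∀ x' ∈ Set.Icc 0 L, nonConnProb H L x x' *
      ENNReal.ofReal (Real.exp
        ((∫⁻ y in Set.Icc 0 L, nonConnProb H L x y * nonConnProb H L x' y).toReal - L)) ≤
      ENNReal.ofReal (Real.exp (-(4 * I))) *
        (1 + ENNReal.ofReal (Real.exp c) * commonConn H L x x') := by
    intro x hx x' hx'
    have hle := commonConn_le hH hH1 hx hx'
    have hfin : commonConn H L x x' ≠ ∞ := ne_top_of_le_ne_top ENNReal.ofReal_ne_top hle
    -- The requirement that `x` and `x'` be unconnected is dropped, which only increases the bound.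
    refine (mul_le_of_le_one_left' (nonConnProb_le_one H L x x')).trans ?_
    rw [lintegral_nonConnProb_mul hH hH1 hx hx', Real.exp_add,
      ENNReal.ofReal_mul (Real.exp_nonneg _)]
    refine mul_le_mul_right ?_ _
    have hq : (commonConn H L x x').toReal ≤ c :=
      (ENNReal.toReal_le_of_le_ofReal (by positivity) hle).trans hc
    refine (ENNReal.ofReal_le_ofReal (hexp _ ENNReal.toReal_nonneg hq)).trans_eq ?_
    rw [ENNReal.ofReal_add zero_le_one (by positivity), ENNReal.ofReal_one,
      ENNReal.ofReal_mul (Real.exp_nonneg _), ENNReal.ofReal_toReal hfin]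
  have hcm : Measurable (Function.uncurry (commonConn H L)) := by
    have hp := measurable_connProb hH L
    have : Measurable (Function.uncurry fun (q : ℝ × ℝ) (y : ℝ) =>
        connProb H L q.1 y * connProb H L q.2 y) :=
      (hp.comp ((measurable_fst.comp measurable_fst).prodMk measurable_snd)).mul
        (hp.comp ((measurable_snd.comp measurable_fst).prodMk measurable_snd))
    exact this.lintegral_prod_right
  have hc1 : ∀ x, Measurable fun x' => commonConn H L x x' := fun x =>
    hcm.of_uncurry_left
  have hc2 : Measurable fun x => ∫⁻ x' in Set.Icc 0 L, commonConn H L x x' :=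
    hcm.lintegral_prod_right
  refine (setLIntegral_mono' measurableSet_Icc fun x hx =>
    setLIntegral_mono' measurableSet_Icc (key x hx)).trans_eq ?_
  have hin : ∀ x, ∫⁻ x' in Set.Icc 0 L, ENNReal.ofReal (Real.exp (-(4 * I))) *
        (1 + ENNReal.ofReal (Real.exp c) * commonConn H L x x') =
      ENNReal.ofReal (Real.exp (-(4 * I))) * (ENNReal.ofReal L +
        ENNReal.ofReal (Real.exp c) * ∫⁻ x' in Set.Icc 0 L, commonConn H L x x') := by
    intro x
    have hm : Measurable fun x' => 1 + ENNReal.ofReal (Real.exp c) * commonConn H L x x' :=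
      measurable_const.add ((hc1 x).const_mul _)
    rw [lintegral_const_mul _ hm, lintegral_add_left measurable_const, lintegral_const_mul _ (hc1 x)]
    simp
  simp_rw [hin]
  have hm : Measurable fun x => ENNReal.ofReal L +
      ENNReal.ofReal (Real.exp c) * ∫⁻ x' in Set.Icc 0 L, commonConn H L x x' :=
    measurable_const.add (hc2.const_mul _)
  rw [lintegral_const_mul _ hm,
    lintegral_add_left measurable_const, lintegral_const_mul _ hc2,
    lintegral_lintegral_commonConn hH hH1 hL, ← hIdef, setLIntegral_const, Real.volume_Icc,
    sub_zero, ← ENNReal.ofReal_mul hL, ← ENNReal.ofReal_mul (by positivity),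
    ← ENNReal.ofReal_add (by positivity) (by positivity), ← ENNReal.ofReal_mul (by positivity), ← sq]

end IsSoftRGG

/-! ### Variance bound and Chebyshev's inequality -/

theorem halfIntegral_le_l1Norm {H : ℝ → ℝ} (hH1 : ∀ r : ℝ, 0 ≤ r → 0 ≤ H r ∧ H r ≤ 1)
    (hint : IntegrableOn H (Set.Ioi (0 : ℝ))) {L : ℝ} (hL : 0 ≤ L) :
    ∫ r in (0 : ℝ)..(L / 2), H r ≤ l1Norm H := by
  rw [intervalIntegral.integral_of_le (by linarith), l1Norm]
  refine setIntegral_mono_set hint ?_ Set.Ioc_subset_Ioi_self.eventuallyLE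
  exact (ae_restrict_iff' measurableSet_Ioi).2
    (Eventually.of_forall fun r hr => (hH1 r (le_of_lt hr)).1)

namespace IsSoftRGG

variable {Ω : Type u} [MeasurableSpace Ω] {P : Measure Ω} {L : ℝ} {H : ℝ → ℝ}
  {Φ : Ω → Finset ℝ} {G : Ω → SimpleGraph ℝ}

theorem measurable_numIsolated [IsFiniteMeasure P] (h : IsSoftRGG P L H Φ G) (hH : Measurable H)
    (hH1 : ∀ r : ℝ, 0 ≤ r → 0 ≤ H r ∧ H r ≤ 1) : Measurable (numIsolated Φ G) := by
  convert! (h.measurable_isoCount hH hH1).ennreal_toReal using 1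
  funext ω
  simp [numIsolated_eq]

theorem lintegral_isoCount_sq_le [IsProbabilityMeasure P] (h : IsSoftRGG P L H Φ G)
    (hL : 0 ≤ L) (hH : Measurable H) (hH1 : ∀ r : ℝ, 0 ≤ r → 0 ≤ H r ∧ H r ≤ 1) {c : ℝ}
    (hc : 2 * ∫ r in (0 : ℝ)..(L / 2), H r ≤ c) :
    ∫⁻ ω, (isoCount (Φ ω) (G ω) : ℝ≥0∞) ^ 2 ∂P ≤
      ENNReal.ofReal (L * Real.exp (-2 * ∫ r in (0 : ℝ)..(L / 2), H r) +
        Real.exp (-(4 * ∫ r in (0 : ℝ)..(L / 2), H r)) *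
        (L ^ 2 + Real.exp c * (L * (2 * ∫ r in (0 : ℝ)..(L / 2), H r) ^ 2))) := by
  simp_rw [isoCount_sq_eq_sum]
  rw [lintegral_add_left (h.measurable_isoCount hH hH1), h.lintegral_isoCount hL hH hH1,
    ENNReal.ofReal_add (by positivity) (by positivity)]
  exact add_le_add_right (h.lintegral_isolated_pairs_le hL hH hH1 hc) _

theorem integral_numIsolated [IsProbabilityMeasure P] (h : IsSoftRGG P L H Φ G)
    (hL : 0 ≤ L) (hH : Measurable H) (hH1 : ∀ r : ℝ, 0 ≤ r → 0 ≤ H r ∧ H r ≤ 1) :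
    ∫ ω, numIsolated Φ G ω ∂P = L * Real.exp (-2 * ∫ r in (0 : ℝ)..(L / 2), H r) := by
  rw [integral_eq_lintegral_of_nonneg_ae
    (Eventually.of_forall fun ω => by rw [numIsolated_eq]; positivity)
    (h.measurable_numIsolated hH hH1).aestronglyMeasurable]
  simp_rw [numIsolated_eq, ENNReal.ofReal_natCast]
  rw [h.lintegral_isoCount hL hH hH1, ENNReal.toReal_ofReal (by positivity)]

theorem lintegral_ofReal_numIsolated_sq :
    ∫⁻ ω, ENNReal.ofReal (numIsolated Φ G ω ^ 2) ∂P =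
      ∫⁻ ω, (isoCount (Φ ω) (G ω) : ℝ≥0∞) ^ 2 ∂P := by
  refine lintegral_congr fun ω => ?_
  rw [numIsolated_eq, ENNReal.ofReal_pow (by positivity), ENNReal.ofReal_natCast]

theorem memLp_numIsolated [IsProbabilityMeasure P] (h : IsSoftRGG P L H Φ G)
    (hL : 0 ≤ L) (hH : Measurable H) (hH1 : ∀ r : ℝ, 0 ≤ r → 0 ≤ H r ∧ H r ≤ 1) :
    MemLp (numIsolated Φ G) 2 P := by
  have hm := h.measurable_numIsolated hH hH1
  rw [memLp_two_iff_integrable_sq hm.aestronglyMeasurable]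
  refine ⟨(hm.pow_const 2).aestronglyMeasurable, ?_⟩
  rw [hasFiniteIntegral_iff_ofReal (Eventually.of_forall fun ω => sq_nonneg _),
    lintegral_ofReal_numIsolated_sq]
  -- Finiteness alone is needed, so `c` is the half-torus integral doubled and no integrability of
  -- `H` on the half-line enters.
  exact (h.lintegral_isoCount_sq_le hL hH hH1 le_rfl).trans_lt ENNReal.ofReal_lt_top

theorem sqCoeffVar_numIsolated_le [IsProbabilityMeasure P] (h : IsSoftRGG P L H Φ G)
    (hL : 0 < L) (hH : Measurable H) (hH1 : ∀ r : ℝ, 0 ≤ r → 0 ≤ H r ∧ H r ≤ 1)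
    (hint : IntegrableOn H (Set.Ioi (0 : ℝ))) :
    sqCoeffVar P (numIsolated Φ G) ≤ 1 / (∫ ω, numIsolated Φ G ω ∂P) +
      4 * Real.exp (2 * l1Norm H) * l1Norm H ^ 2 / L := by
  have hI := halfIntegral_nonneg hH1 hL.le
  have hIle := halfIntegral_le_l1Norm hH1 hint hL.le
  -- This choice of `c` makes the constant `exp (2 ‖H‖₁)` independent of `L`.
  have hc : 2 * ∫ r in (0 : ℝ)..(L / 2), H r ≤ 2 * l1Norm H := by linarith
  have hsq := h.lintegral_isoCount_sq_le hL.le hH hH1 hc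
  have hmean := h.integral_numIsolated hL.le hH hH1
  have hm := h.measurable_numIsolated hH hH1
  generalize (∫ r in (0 : ℝ)..(L / 2), H r) = I at hI hIle hsq hmean hc
  have h2 : ∫ ω, numIsolated Φ G ω ^ 2 ∂P ≤ L * Real.exp (-2 * I) +
      Real.exp (-(4 * I)) * (L ^ 2 + Real.exp (2 * l1Norm H) * (L * (2 * I) ^ 2)) := by
    rw [integral_eq_lintegral_of_nonneg_ae (Eventually.of_forall fun ω => sq_nonneg _)
      (hm.pow_const 2).aestronglyMeasurable, lintegral_ofReal_numIsolated_sq]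
    exact ENNReal.toReal_le_of_le_ofReal (by positivity) hsq
  have hvar : variance (numIsolated Φ G) P = (∫ ω, numIsolated Φ G ω ^ 2 ∂P) -
      (∫ ω, numIsolated Φ G ω ∂P) ^ 2 :=
    variance_eq_sub (h.memLp_numIsolated hL.le hH hH1)
  have he : Real.exp (-(4 * I)) = Real.exp (-2 * I) ^ 2 := by
    rw [← Real.exp_nat_mul]
    congr 1
    push_cast
    ring
  have hE : 0 < Real.exp (-2 * I) := Real.exp_pos _
  rw [sqCoeffVar, hvar, hmean]
  rw [he] at h2
  set E := Real.exp (-2 * I)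
  set C := Real.exp (2 * l1Norm H) with hC
  have hCpos : 0 < C := Real.exp_pos _
  rw [div_le_iff₀ (by positivity)]
  have h3 : (1 / (L * E) + 4 * C * l1Norm H ^ 2 / L) * (L * E) ^ 2 =
      L * E + E ^ 2 * (C * (L * (4 * l1Norm H ^ 2))) := by
    field_simp
  have h4 : I ^ 2 ≤ l1Norm H ^ 2 := pow_le_pow_left₀ hI hIle 2
  have h5 : E ^ 2 * (C * (L * (2 * I) ^ 2)) ≤ E ^ 2 * (C * (L * (4 * l1Norm H ^ 2))) := by
    have : (2 * I) ^ 2 ≤ 4 * l1Norm H ^ 2 := by linarith [mul_pow 2 I 2]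
    gcongr
  rw [h3]
  linarith [mul_pow L E 2]

theorem measureReal_deviation_le [IsProbabilityMeasure P] (h : IsSoftRGG P L H Φ G)
    (hL : 0 < L) (hH : Measurable H) (hH1 : ∀ r : ℝ, 0 ≤ r → 0 ≤ H r ∧ H r ≤ 1) {ε : ℝ}
    (hε : 0 < ε) :
    P.real {ω | |numIsolated Φ G ω - ∫ ω', numIsolated Φ G ω' ∂P| >
        ε * ∫ ω', numIsolated Φ G ω' ∂P} ≤ sqCoeffVar P (numIsolated Φ G) / ε ^ 2 := by
  have hmean := h.integral_numIsolated hL.le hH hH1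
  have hpos : 0 < ∫ ω', numIsolated Φ G ω' ∂P := by rw [hmean]; positivity
  have hch := meas_ge_le_variance_div_sq (h.memLp_numIsolated hL.le hH hH1)
    (mul_pos hε hpos)
  have hv : 0 ≤ variance (numIsolated Φ G) P := variance_nonneg _ _
  have hle : P {ω | |numIsolated Φ G ω - ∫ ω', numIsolated Φ G ω' ∂P| >
      ε * ∫ ω', numIsolated Φ G ω' ∂P} ≤ _ :=
    le_trans (measure_mono (Set.ofPred_subset_ofPred.2 fun _ hω => le_of_lt hω)) hch
  refine (ENNReal.toReal_le_of_le_ofReal (by positivity) hle).trans_eq ?_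
  rw [sqCoeffVar]
  field_simp

end IsSoftRGG

/-! ### The limit of large systems and the main theorem -/

theorem tendsto_halfIntegral {H : ℝ → ℝ} (hint : IntegrableOn H (Set.Ioi (0 : ℝ))) :
    Tendsto (fun L : ℝ => ∫ r in (0 : ℝ)..(L / 2), H r) atTop (𝓝 (l1Norm H)) :=
  intervalIntegral_tendsto_integral_Ioi 0 hint (tendsto_id.atTop_div_const two_pos)

end

theorem mainTheorem2 (H : ℝ → ℝ) (hH_meas : Measurable H)
    (hH_range : ∀ r : ℝ, 0 ≤ r → 0 ≤ H r ∧ H r ≤ 1)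
    (hH_int : IntegrableOn H (Set.Ioi (0 : ℝ))) :
    -- for every system size: mean, variance bound with a constant depending only on `H`, Chebyshev
    (∃ C : ℝ, ∀ L : ℝ, 0 < L →
      ∀ (Ω : Type u) [MeasurableSpace Ω] (P : Measure Ω) [IsProbabilityMeasure P]
        (Φ : Ω → Finset ℝ) (G : Ω → SimpleGraph ℝ), IsSoftRGG P L H Φ G →
        MemLp (numIsolated Φ G) 2 P ∧
        ∫ ω, numIsolated Φ G ω ∂P = L * Real.exp (-2 * ∫ r in (0 : ℝ)..(L / 2), H r) ∧
        sqCoeffVar P (numIsolated Φ G) ≤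
          1 / (∫ ω, numIsolated Φ G ω ∂P) + 4 * C * l1Norm H ^ 2 / L ∧
        ∀ ε : ℝ, 0 < ε →
          P.real {ω | |numIsolated Φ G ω - ∫ ω', numIsolated Φ G ω' ∂P| >
              ε * ∫ ω', numIsolated Φ G ω' ∂P} ≤
            sqCoeffVar P (numIsolated Φ G) / ε ^ 2) ∧
    -- as the system size tends to infinity: linear growth and concentration
    (∀ (Ω : ℝ → Type u) [∀ L, MeasurableSpace (Ω L)] (P : ∀ L, Measure (Ω L))
      [∀ L, IsProbabilityMeasure (P L)]
      (Φ : ∀ L, Ω L → Finset ℝ) (G : ∀ L, Ω L → SimpleGraph ℝ),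
      (∀ L : ℝ, 0 < L → IsSoftRGG (P L) L H (Φ L) (G L)) →
      Tendsto (fun L : ℝ => (∫ ω, numIsolated (Φ L) (G L) ω ∂(P L)) / L) atTop
        (𝓝 (Real.exp (-2 * l1Norm H))) ∧
      ∀ ε : ℝ, 0 < ε →
        Tendsto (fun L : ℝ => (P L).real
          {ω | |numIsolated (Φ L) (G L) ω - ∫ ω', numIsolated (Φ L) (G L) ω' ∂(P L)| >
            ε * ∫ ω', numIsolated (Φ L) (G L) ω' ∂(P L)}) atTop (𝓝 0) ∧
        Tendsto (fun L : ℝ => (P L).real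
          {ω | |numIsolated (Φ L) (G L) ω / L - Real.exp (-2 * l1Norm H)| > ε})
          atTop (𝓝 0)) := by
  refine ⟨⟨Real.exp (2 * l1Norm H), fun L hL Ω _ P _ Φ G h =>
    ⟨h.memLp_numIsolated hL.le hH_meas hH_range, h.integral_numIsolated hL.le hH_meas hH_range,
      h.sqCoeffVar_numIsolated_le hL hH_meas hH_range hH_int,
      fun ε hε => h.measureReal_deviation_le hL hH_meas hH_range hε⟩⟩, ?_⟩
  intro Ω _ P _ Φ G h
  have hmean : ∀ L : ℝ, 0 < L → (∫ ω, numIsolated (Φ L) (G L) ω ∂(P L)) =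
      L * Real.exp (-2 * ∫ r in (0 : ℝ)..(L / 2), H r) := fun L hL =>
    (h L hL).integral_numIsolated hL.le hH_meas hH_range
  have hgrowth : Tendsto (fun L : ℝ => (∫ ω, numIsolated (Φ L) (G L) ω ∂(P L)) / L) atTop
      (𝓝 (Real.exp (-2 * l1Norm H))) := by
    have h1 : Tendsto (fun L : ℝ => Real.exp (-2 * ∫ r in (0 : ℝ)..(L / 2), H r)) atTop
        (𝓝 (Real.exp (-2 * l1Norm H))) :=
      (Real.continuous_exp.tendsto _).comp ((tendsto_halfIntegral hH_int).const_mul (-2))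
    refine h1.congr' ?_
    filter_upwards [eventually_gt_atTop 0] with L hL
    rw [hmean L hL]
    field_simp
  have hbound : ∀ ε : ℝ, 0 < ε → Tendsto (fun L : ℝ => (P L).real
      {ω | |numIsolated (Φ L) (G L) ω - ∫ ω', numIsolated (Φ L) (G L) ω' ∂(P L)| >
        ε * ∫ ω', numIsolated (Φ L) (G L) ω' ∂(P L)}) atTop (𝓝 0) := by
    intro ε hε
    -- The reciprocal of the mean is written as `(mean / L)⁻¹ * L⁻¹`, whose first factor converges
    -- because the limit of `mean / L` is positive.
    have hlim : Tendsto (fun L : ℝ => (((∫ ω, numIsolated (Φ L) (G L) ω ∂(P L)) / L)⁻¹ * L⁻¹ +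
        4 * Real.exp (2 * l1Norm H) * l1Norm H ^ 2 * L⁻¹) / ε ^ 2) atTop (𝓝 0) := by
      have h1 := hgrowth.inv₀ (Real.exp_pos _).ne'
      have h2 := ((h1.mul tendsto_inv_atTop_zero).add (tendsto_inv_atTop_zero.const_mul
        (4 * Real.exp (2 * l1Norm H) * l1Norm H ^ 2))).div_const (ε ^ 2)
      simpa using h2
    refine squeeze_zero' (Eventually.of_forall fun L => measureReal_nonneg) ?_ hlim
    filter_upwards [eventually_gt_atTop 0] with L hL
    refine ((h L hL).measureReal_deviation_le hL hH_meas hH_range hε).trans ?_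
    refine div_le_div_of_nonneg_right ?_ (by positivity)
    refine ((h L hL).sqCoeffVar_numIsolated_le hL hH_meas hH_range hH_int).trans_eq ?_
    rw [inv_div, div_mul_eq_mul_div, mul_inv_cancel₀ hL.ne', div_eq_mul_inv _ L]
  refine ⟨hgrowth, fun ε hε => ⟨hbound ε hε, ?_⟩⟩
  -- Half of `ε` absorbs the distance of `mean / L` from its limit. A deviation of `N / L` from
  -- `mean / L` beyond `ε / 2` is a relative deviation beyond `ε / 2`, because the mean is at most
  -- `L`.
  refine squeeze_zero' (Eventually.of_forall fun L => measureReal_nonneg) ?_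
    (hbound (ε / 2) (half_pos hε))
  filter_upwards [eventually_gt_atTop 0, Metric.tendsto_nhds.1 hgrowth (ε / 2) (half_pos hε)]
    with L hL hclose
  refine measureReal_mono fun ω hω => ?_
  simp only [Set.mem_ofPred_eq, gt_iff_lt] at hω ⊢
  rw [Real.dist_eq] at hclose
  set m := ∫ ω', numIsolated (Φ L) (G L) ω' ∂(P L) with hm
  have hmL : m ≤ L := by
    rw [hm, hmean L hL]
    refine mul_le_of_le_one_right hL.le (Real.exp_le_one_iff.2 ?_)
    linarith [halfIntegral_nonneg hH_range hL.le]
  have h1 : ε / 2 < |numIsolated (Φ L) (G L) ω / L - m / L| := by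
    have := abs_sub_le (numIsolated (Φ L) (G L) ω / L) (m / L) (Real.exp (-2 * l1Norm H))
    linarith
  rw [← sub_div, abs_div, abs_of_pos hL, lt_div_iff₀ hL] at h1
  exact (mul_le_mul_of_nonneg_left hmL (half_pos hε).le).trans_lt h1
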